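/- Let $R$ be a commutative ring with unit and let $I\subseteq R$ be an ideal generated by a finite regular sequence $r_1,\dots,r_m$, i.e. each $r_i$ is a non-zero-divisor on $R/(r_1,\dots,r_{i-1})$ (the degenerate cases $m=0$ and $I=R$ are allowed). Fix $s\ge 0$, with the convention $I^0=R$. Let $$p_*\colon \operatorname{Tor}_n^R(R/I, I^s)\to \operatorname{Tor}_n^R(R/I, I^s/I^{s+1})$$ be the map induced by the projection $I^s\to I^s/I^{s+1}$, and let $$\delta\colon \operatorname{Tor}_{n}^R(R/I, I^s/I^{s+1})\to \operatorname{Tor}_{n-1}^R(R/I, I^{s+1})$$ be the connecting homomorphism associated with the short exact sequence $0\to I^{s+1}\to I^s\to I^s/I^{s+1}\to 0$. Then for every $n\ge 0$ the sequence of $R/I$-modules $$0 \to \operatorname{Tor}_n^R(R/I, I^s) \xrightarrow{\ p_*\ } \operatorname{Tor}_n^R(R/I, I^s/I^{s+1}) \xrightarrow{\ \delta\ } \operatorname{Tor}_{n-1}^R(R/I, I^{s+1}) \to 0$$ is exact, where $\operatorname{Tor}_{-1}^R=0$ (so for $n=0$ the map $p_*$ is an isomorphism). Moreover, for every $n\ge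 0$, the $R/I$-modules $\operatorname{Tor}_n^R(R/I, I^s)$, $\operatorname{Tor}_n^R(R/I, I^s/I^{s+1})$ and $\operatorname{Tor}_n^R(R/I, I^{s+1})$ are free. -/

import Mathlib

open CategoryTheory MonoidalCategory

universe u

noncomputable section

namespace RegularTor

section LongExact

variable {R : Type u} [CommRing R]

/-- `Tor_n^R(M, N)`: the `n`-th left derived functor of `- ⊗ N`, evaluated at `M`. -/
abbrev TorObj (n : ℕ) (M N : ModuleCat.{u} R) : ModuleCat.{u} R :=
  ((Tor' (ModuleCat.{u} R) n).obj M).obj N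

/-- The map `Tor_n^R(M, A) ⟶ Tor_n^R(M, B)` induced by `A ⟶ B`. -/
abbrev torObjMap (n : ℕ) (M : ModuleCat.{u} R) {A B : ModuleCat.{u} R} (f : A ⟶ B) :
    TorObj n M A ⟶ TorObj n M B :=
  ((Tor' (ModuleCat.{u} R) n).obj M).map f

/-- For a complex `P` and a short complex `A ⟶ B ⟶ C` of modules, the short complex of
complexes `P ⊗ A ⟶ P ⊗ B ⟶ P ⊗ C`. -/
def tensorShortComplex (P : ChainComplex (ModuleCat.{u} R) ℕ)
    (S : ShortComplex (ModuleCat.{u} R)) :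
    ShortComplex (ChainComplex (ModuleCat.{u} R) ℕ) where
  X₁ := (((tensoringRight (ModuleCat.{u} R)).obj S.X₁).mapHomologicalComplex _).obj P
  X₂ := (((tensoringRight (ModuleCat.{u} R)).obj S.X₂).mapHomologicalComplex _).obj P
  X₃ := (((tensoringRight (ModuleCat.{u} R)).obj S.X₃).mapHomologicalComplex _).obj P
  f := (NatTrans.mapHomologicalComplex ((tensoringRight (ModuleCat.{u} R)).map S.f) _).app P
  g := (NatTrans.mapHomologicalComplex ((tensoringRight (ModuleCat.{u} R)).map S.g) _).app P
  zero := by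
    ext i : 1
    change (P.X i ◁ S.f) ≫ (P.X i ◁ S.g) = 0
    rw [← MonoidalCategory.whiskerLeft_comp, S.zero, MonoidalPreadditive.whiskerLeft_zero]

theorem tensorShortComplex_shortExact {M : ModuleCat.{u} R} (P : ProjectiveResolution M)
    {S : ShortComplex (ModuleCat.{u} R)} (hS : S.ShortExact) :
    (tensorShortComplex P.complex S).ShortExact := by
  refine HomologicalComplex.shortExact_of_degreewise_shortExact _ fun i => ?_
  have hp : Module.Projective R (P.complex.X i) :=
    (IsProjective.iff_projective (P.complex.X i)).2 (P.projective i)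
  have hex := (ShortComplex.ShortExact.moduleCat_exact_iff_function_exact S).1 hS.exact
  refine ModuleCat.shortComplex_shortExact _ ?_ ?_ ?_
  · exact Module.Flat.lTensor_exact (P.complex.X i) hex
  · exact Module.Flat.lTensor_preserves_injective_linearMap (M := P.complex.X i) S.f.hom
      hS.moduleCat_injective_f
  · exact LinearMap.lTensor_surjective (P.complex.X i) hS.moduleCat_surjective_g

/-- The connecting homomorphism `Tor_{n+1}^R(M, C) ⟶ Tor_n^R(M, A)` of a short exact sequence
`0 ⟶ A ⟶ B ⟶ C ⟶ 0`, i.e. the connecting homomorphism in the homology of the short exact sequence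
of complexes `0 ⟶ P ⊗ A ⟶ P ⊗ B ⟶ P ⊗ C ⟶ 0`, for a projective resolution `P` of `M`. -/
def torObjδ (n : ℕ) (M : ModuleCat.{u} R) {S : ShortComplex (ModuleCat.{u} R)}
    (hS : S.ShortExact) : TorObj (n + 1) M S.X₃ ⟶ TorObj n M S.X₁ :=
  ((projectiveResolution M).isoLeftDerivedObj
      ((tensoringRight (ModuleCat.{u} R)).obj S.X₃) (n + 1)).hom ≫
    (tensorShortComplex_shortExact (projectiveResolution M) hS).δ (n + 1) n (by simp) ≫
    ((projectiveResolution M).isoLeftDerivedObj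
      ((tensoringRight (ModuleCat.{u} R)).obj S.X₁) n).inv

end LongExact

section Quotient

variable {R : Type u} [CommRing R] (I : Ideal R)

/-- The underlying type of `Tor_n^R(R/I, N)`. -/
abbrev TorQuot (n : ℕ) (N : ModuleCat.{u} R) : Type u :=
  TorObj n (ModuleCat.of R (R ⧸ I)) N

theorem torQuot_isTorsionBySet (n : ℕ) (N : ModuleCat.{u} R) :
    Module.IsTorsionBySet R (TorQuot I n N) I := by
  rintro x ⟨r, hr⟩
  let M : ModuleCat.{u} R := ModuleCat.of R (R ⧸ I)
  let P := projectiveResolution M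
  let F := (tensoringRight (ModuleCat.{u} R)).obj N
  have h0 : r • 𝟙 M = 0 := by
    refine ModuleCat.hom_ext (LinearMap.ext fun (y : R ⧸ I) => ?_)
    obtain ⟨y, rfl⟩ := Ideal.Quotient.mk_surjective y
    change r • (Ideal.Quotient.mk I y) = 0
    rw [← Ideal.Quotient.mk_eq_mk, ← Submodule.Quotient.mk_smul]
    exact (Submodule.Quotient.mk_eq_zero _).2 (I.mul_mem_right y hr)
  have h0' (A : ModuleCat.{u} R) (f : A ⟶ M) : r • f = 0 := by
    rw [← Category.comp_id f, ← Linear.comp_smul, h0, Limits.comp_zero]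
  have hw : (r • 𝟙 P.complex) ≫ P.π = P.π ≫ (ChainComplex.single₀ _).map (0 : M ⟶ M) := by
    rw [Functor.map_zero, Limits.comp_zero, Linear.smul_comp, Category.id_comp]
    refine HomologicalComplex.hom_ext _ _ fun i => ?_
    cases i with
    | zero => exact h0' _ (P.π.f 0)
    | succ i => exact (HomologicalComplex.isZero_single_obj_X _ _ _ _ (by simp)).eq_of_tgt _ _
  have hs : (F.mapHomologicalComplex _ ⋙ HomologicalComplex.homologyFunctor _ _ n).map
      (r • 𝟙 P.complex) = r • 𝟙 ((HomologicalComplex.homologyFunctor _ _ n).obj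
        ((F.mapHomologicalComplex _).obj P.complex)) := by
    rw [← CategoryTheory.Functor.map_id, Functor.comp_map, Functor.map_smul,
      CategoryTheory.Functor.map_id]
    exact ShortComplex.homologyMap_smul ((HomologicalComplex.shortComplexFunctor _ _ n).map
      (𝟙 ((F.mapHomologicalComplex _).obj P.complex))) r
  have h1 := Functor.leftDerived_map_eq F n (0 : M ⟶ M) (r • 𝟙 P.complex) hw
  have h2 : r • 𝟙 ((F.leftDerived n).obj M) = 0 := by
    have h3 : (F.leftDerived n).map (0 : M ⟶ M) = 0 := by
      rw [Functor.leftDerived_map_eq F n (0 : M ⟶ M) (0 : P.complex ⟶ P.complex) (by simp),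
        Functor.map_zero, Limits.zero_comp, Limits.comp_zero]
    rw [← h3, h1, hs, Linear.smul_comp, Linear.comp_smul, Category.id_comp, Iso.hom_inv_id]
  exact congrArg (fun φ => φ.hom x) h2

/-- The `R/I`-module structure on `Tor_n^R(R/I, N)`: the class of `r` acts as `r`. -/
instance torQuotModule (n : ℕ) (N : ModuleCat.{u} R) : Module (R ⧸ I) (TorQuot I n N) :=
  (torQuot_isTorsionBySet I n N).module

instance torQuotIsScalarTower (n : ℕ) (N : ModuleCat.{u} R) :
    IsScalarTower R (R ⧸ I) (TorQuot I n N) :=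
  (torQuot_isTorsionBySet I n N).isScalarTower

/-- The `R/I`-linear map `Tor_n^R(R/I, A) → Tor_n^R(R/I, B)` induced by `A ⟶ B`. -/
def torMap (n : ℕ) {A B : ModuleCat.{u} R} (f : A ⟶ B) :
    TorQuot I n A →ₗ[R ⧸ I] TorQuot I n B :=
  (torObjMap n (ModuleCat.of R (R ⧸ I)) f).hom.extendScalarsOfSurjective
    Ideal.Quotient.mk_surjective

/-- The connecting homomorphism `Tor_{n+1}^R(R/I, C) → Tor_n^R(R/I, A)` of a short exact sequence
`0 ⟶ A ⟶ B ⟶ C ⟶ 0` of `R`-modules, as an `R/I`-linear map. -/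
def torδ (n : ℕ) {S : ShortComplex (ModuleCat.{u} R)} (hS : S.ShortExact) :
    TorQuot I (n + 1) S.X₃ →ₗ[R ⧸ I] TorQuot I n S.X₁ :=
  (torObjδ n (ModuleCat.of R (R ⧸ I)) hS).hom.extendScalarsOfSurjective
    Ideal.Quotient.mk_surjective

end Quotient

section Powers

variable {R : Type u} [CommRing R] (I : Ideal R)

/-- The sequence `I^(s+1) ⟶ I^s ⟶ I^s/I^(s+1)` of `R`-modules, where `I^0 = R`. -/
def powShortComplex (s : ℕ) : ShortComplex (ModuleCat.{u} R) where
  X₁ := ModuleCat.of R ↥(I ^ (s + 1))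
  X₂ := ModuleCat.of R ↥(I ^ s)
  X₃ := ModuleCat.of R (↥(I ^ s) ⧸ Submodule.submoduleOf (I ^ (s + 1)) (I ^ s))
  f := ModuleCat.ofHom (Submodule.inclusion (Ideal.pow_le_pow_right (Nat.le_succ s)))
  g := ModuleCat.ofHom (Submodule.mkQ (Submodule.submoduleOf (I ^ (s + 1)) (I ^ s)))
  zero := by
    ext x
    exact (Submodule.Quotient.mk_eq_zero _).2 x.2

theorem powShortComplex_shortExact (s : ℕ) : (powShortComplex I s).ShortExact := by
  refine ModuleCat.shortComplex_shortExact _ ?_ ?_ ?_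
  · intro y
    constructor
    · intro hy
      exact ⟨⟨y.1, (Submodule.Quotient.mk_eq_zero
        (Submodule.submoduleOf (I ^ (s + 1)) (I ^ s)) (x := y)).1 hy⟩, rfl⟩
    · rintro ⟨x, rfl⟩
      exact (Submodule.Quotient.mk_eq_zero _).2 x.2
  · exact Submodule.inclusion_injective (Ideal.pow_le_pow_right (Nat.le_succ s))
  · exact Submodule.mkQ_surjective _

end Powers

end RegularTor

end

/-!
The Koszul complex `K` of a regular sequence `r` is a free resolution of `R/I`, and `Tor(R/I, J)` is
the homology of `J ⊗ K = J K` for every ideal `J`. The degree `t` part of `K` with coefficients in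
`I^t` is the image of the corresponding strand of the Koszul complex of the variables over the
polynomial ring `R[X]`, evaluated at `r`. The polynomial complex is contractible off bidegree
`(0, 0)`, which splits each strand into the boundaries and a free complement, the reduced strand,
spanned by the basis vectors whose largest index is exterior.

A cycle in `I^(t+1) K` is a boundary `d w` of the Koszul complex (in degree `0` because `d` maps
onto `I`). Quasi-regularity of `r`, that a form vanishing at `r` has coefficients in `I`, allows one
to raise the power of `I` that contains the coefficients of `w` one step at a time, up to the value
at `r` of an element of the reduced strand of degree `t`; quasi-regularity itself follows from
Koszul exactness by the same induction. Hence `w` lies in `I^t K`, the map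
`Tor(R/I, I^(t+1)) → Tor(R/I, I^t)` is zero and the long exact sequence breaks up. Moreover
`Tor(R/I, I^(t+1))` is the reduced strand modulo `I`, which is free over `R/I`, and
`Tor(R/I, I^t/I^(t+1))` is an extension of free modules.
-/

open scoped Finset

section KoszulDifferential

variable {σ : Type*} [LinearOrder σ] {A : Type*} [CommRing A]

/-- The Koszul differential of a family `r`, where `Finsupp.single S 1` stands for the exterior
product of the basis vectors in `S`. The sign of the term that drops `i` counts the elements of `S`
above `i`, so that adjoining a new largest index introduces no sign. -/
noncomputable def koszulD (r : σ → A) : (Finset σ →₀ A) →ₗ[A] (Finset σ →₀ A) :=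
  Finsupp.linearCombination A fun S =>
    ∑ i ∈ S, Finsupp.single (S.erase i) ((-1) ^ #{j ∈ S | i < j} * r i)

/-- Exterior multiplication by the basis vector of `a`, correct up to sign on vectors that do not
involve `a`. -/
noncomputable def koszulWedge (a : σ) : (Finset σ →₀ A) →ₗ[A] (Finset σ →₀ A) :=
  Finsupp.lmapDomain A A (insert a)

theorem koszulD_single (r : σ → A) (S : Finset σ) (c : A) :
    koszulD r (Finsupp.single S c) =
      ∑ i ∈ S, Finsupp.single (S.erase i) (c * ((-1) ^ #{j ∈ S | i < j} * r i)) := by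
  simp only [koszulD, Finsupp.linearCombination_single, Finset.smul_sum, Finsupp.smul_single,
    smul_eq_mul]

@[simp]
theorem koszulWedge_single (a : σ) (S : Finset σ) (c : A) :
    koszulWedge a (Finsupp.single S c) = Finsupp.single (insert a S) c :=
  Finsupp.mapDomain_single

theorem koszulD_single_insert (r : σ → A) {a : σ} {S : Finset σ} (hS : ∀ j ∈ S, j < a) (c : A) :
    koszulD r (Finsupp.single (insert a S) c) =
      r a • Finsupp.single S c - koszulWedge a (koszulD r (Finsupp.single S c)) := by
  have haS : a ∉ S := fun h => (hS a h).false
  have htop : #{j ∈ insert a S | a < j} = 0 := by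
    simpa [Finset.filter_eq_empty_iff] using fun j hj => (hS j hj).le
  have hsign : ∀ i ∈ S, #{j ∈ insert a S | i < j} = #{j ∈ S | i < j} + 1 := fun i hi => by
    rw [Finset.filter_insert, if_pos (hS i hi), Finset.card_insert_of_notMem (by simp [haS])]
  rw [koszulD_single, koszulD_single, Finset.sum_insert haS, map_sum, sub_eq_add_neg,
    ← Finset.sum_neg_distrib, htop, Finset.erase_insert haS]
  congr 1
  · simp [mul_comm]
  · refine Finset.sum_congr rfl fun i hi => ?_
    rw [Finset.erase_insert_of_ne (hS i hi).ne', koszulWedge_single, hsign i hi,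
      ← Finsupp.single_neg]
    congr 1
    ring

theorem koszulD_koszulWedge (r : σ → A) {a : σ} {f : Finset σ →₀ A}
    (hf : f ∈ Finsupp.supported A A {S | ∀ j ∈ S, j < a}) :
    koszulD r (koszulWedge a f) = r a • f - koszulWedge a (koszulD r f) := by
  rw [Finsupp.supported_eq_span_single] at hf
  refine LinearMap.eqOn_span (f := koszulD r ∘ₗ koszulWedge a)
    (g := r a • LinearMap.id - koszulWedge a ∘ₗ koszulD r) ?_ hf
  rintro _ ⟨S, hS, rfl⟩
  simpa using koszulD_single_insert r hS 1

theorem koszulD_mem_supported (r : σ → A) {s t : Set (Finset σ)}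
    (h : ∀ S ∈ s, ∀ i ∈ S, S.erase i ∈ t) {f : Finset σ →₀ A} (hf : f ∈ Finsupp.supported A A s) :
    koszulD r f ∈ Finsupp.supported A A t := by
  rw [Finsupp.supported_eq_span_single] at hf
  refine (Submodule.span_le (p := (Finsupp.supported A A t).comap (koszulD r))).2 ?_ hf
  rintro _ ⟨S, hS, rfl⟩
  rw [SetLike.mem_coe, Submodule.mem_comap, koszulD_single]
  exact Submodule.sum_mem _ fun i hi => Finsupp.single_mem_supported A _ (h S hS i hi)

theorem koszulWedge_mem_supported {a : σ} {s t : Set (Finset σ)} (h : ∀ S ∈ s, insert a S ∈ t)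
    {f : Finset σ →₀ A} (hf : f ∈ Finsupp.supported A A s) :
    koszulWedge a f ∈ Finsupp.supported A A t :=
  Finsupp.supported_mono (Set.image_subset_iff.2 h)
    ((Finsupp.lmapDomain_supported A A (insert a) s).le (Submodule.mem_map_of_mem hf))

theorem koszulD_koszulD (r : σ → A) (f : Finset σ →₀ A) : koszulD r (koszulD r f) = 0 := by
  suffices koszulD r ∘ₗ koszulD r = 0 from LinearMap.congr_fun this f
  ext S : 2
  suffices koszulD r (koszulD r (Finsupp.single S 1)) = 0 by simpa
  induction S using Finset.induction_on_max with
  | empty => simp [koszulD_single]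
  | insert a S hS ih =>
    have hdS : koszulD r (Finsupp.single S 1) ∈ Finsupp.supported A A {S | ∀ j ∈ S, j < a} :=
      koszulD_mem_supported r (s := {S}) (by
        rintro _ rfl i _ j hj
        exact hS j (Finset.mem_of_mem_erase hj)) (Finsupp.single_mem_supported A 1 rfl)
    rw [koszulD_single_insert r hS, map_sub, map_smul, koszulD_koszulWedge r hdS, ih, map_zero,
      sub_zero, sub_self]

theorem koszulD_mapRange {R B : Type*} [CommRing R] [CommRing B] [Algebra R A] [Algebra R B]
    (φ : A →ₐ[R] B) (r : σ → A) (f : Finset σ →₀ A) :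
    koszulD (φ ∘ r) (Finsupp.mapRange.linearMap φ.toLinearMap f) =
      Finsupp.mapRange.linearMap φ.toLinearMap (koszulD r f) := by
  induction f using Finsupp.induction_linear with
  | zero => simp only [map_zero]
  | add f g hf hg => simp only [map_add, hf, hg]
  | single S c =>
    simp only [Finsupp.mapRange.linearMap_apply, Finsupp.mapRange_single, koszulD_single, map_sum,
      AlgHom.toLinearMap_apply, Function.comp_apply, map_mul, map_pow, map_neg, map_one]

end KoszulDifferential

section Acyclicity

variable {σ : Type*} [LinearOrder σ] {A : Type*} [CommRing A] {r : σ → A}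

theorem koszulD_apply_empty_mem_span {T : Finset σ} {f : Finset σ →₀ A}
    (hf : f ∈ Finsupp.supported A A {S | S ⊆ T}) :
    koszulD r f ∅ ∈ Ideal.span (r '' T) := by
  rw [Finsupp.supported_eq_span_single] at hf
  refine (Submodule.span_le
    (p := Submodule.comap (Finsupp.lapply ∅ ∘ₗ koszulD r) (Ideal.span (r '' T)))).2 ?_ hf
  rintro _ ⟨S, hS, rfl⟩
  rw [SetLike.mem_coe, Submodule.mem_comap, LinearMap.comp_apply, koszulD_single, map_sum]
  refine Submodule.sum_mem _ fun i hi => ?_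
  rw [Finsupp.lapply_apply, Finsupp.single_apply]
  split_ifs
  · exact Ideal.mul_mem_left _ _ (Ideal.mul_mem_left _ _
      (Ideal.subset_span (Set.mem_image_of_mem r (hS hi))))
  · exact zero_mem _

theorem koszulWedge_injOn (a : σ) : Set.InjOn (koszulWedge a)
    (Finsupp.supported A A {S : Finset σ | a ∉ S} : Set (Finset σ →₀ A)) :=
  Finsupp.mapDomain_injOn _ fun S (hS : a ∉ S) S' (hS' : a ∉ S') h => by
    rw [← Finset.erase_insert hS, h, Finset.erase_insert hS']

theorem koszulWedge_apply_empty (a : σ) (f : Finset σ →₀ A) : koszulWedge a f ∅ = 0 :=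
  Finsupp.mapDomain_of_notMem_range f ∅ fun ⟨S, hS⟩ => Finset.insert_ne_empty a S hS

theorem exists_eq_add_koszulWedge {a : σ} {T : Finset σ} {f : Finset σ →₀ A}
    (hf : f ∈ Finsupp.supported A A {S | S ⊆ insert a T}) :
    ∃ f₀ ∈ Finsupp.supported A A {S | S ⊆ T}, ∃ f₁ ∈ Finsupp.supported A A {S | S ⊆ T},
      f₀ + koszulWedge a f₁ = f := by
  have hset : {S | S ⊆ insert a T} = {S | S ⊆ T} ∪ insert a '' {S | S ⊆ T} := by
    ext S
    simpa only [Finset.mem_powerset, Finset.mem_union, Finset.mem_image, Set.mem_union,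
      Set.mem_image, Set.mem_ofPred_eq] using
      Finset.ext_iff.1 (Finset.powerset_insert T a) S
  rw [hset, Finsupp.supported_union, ← Finsupp.lmapDomain_supported, Submodule.mem_sup] at hf
  obtain ⟨f₀, hf₀, _, ⟨f₁, hf₁, rfl⟩, h⟩ := hf
  exact ⟨f₀, hf₀, f₁, hf₁, h⟩

theorem eq_zero_of_add_koszulWedge_eq_zero {a : σ} {f₀ f₁ : Finset σ →₀ A}
    (hf₀ : f₀ ∈ Finsupp.supported A A {S : Finset σ | a ∉ S})
    (hf₁ : f₁ ∈ Finsupp.supported A A {S : Finset σ | a ∉ S})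
    (h : f₀ + koszulWedge a f₁ = 0) : f₀ = 0 ∧ f₁ = 0 := by
  have hwedge : koszulWedge a f₁ ∈ Finsupp.supported A A {S : Finset σ | a ∈ S} :=
    koszulWedge_mem_supported (fun S _ => Finset.mem_insert_self a S) hf₁
  have hf₀' : f₀ = 0 := by
    refine Submodule.disjoint_def.1 (Finsupp.disjoint_supported_supported
      (Set.disjoint_left.2 fun S (hS : a ∉ S) (hS' : a ∈ S) => hS hS')) f₀ hf₀ ?_
    rw [eq_neg_of_add_eq_zero_left h]
    exact neg_mem hwedge
  refine ⟨hf₀', koszulWedge_injOn a hf₁ (zero_mem _) ?_⟩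
  rw [map_zero, ← h, hf₀', zero_add]

theorem koszulD_koszulWedge_of_subset (r : σ → A) {a : σ} {T : Finset σ} (hT : ∀ j ∈ T, j < a)
    {f : Finset σ →₀ A} (hf : f ∈ Finsupp.supported A A {S | S ⊆ T}) :
    koszulD r (koszulWedge a f) = r a • f - koszulWedge a (koszulD r f) :=
  koszulD_koszulWedge r (Finsupp.supported_mono (fun S (hS : S ⊆ T) j hj => hT j (hS hj)) hf)

theorem exists_eq_add_koszulWedge_of_koszulD_eq_zero {a : σ} {T : Finset σ}
    (hT : ∀ j ∈ T, j < a) {f : Finset σ →₀ A}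
    (hf : f ∈ Finsupp.supported A A {S | S ⊆ insert a T}) (hdf : koszulD r f = 0) :
    ∃ f₀ ∈ Finsupp.supported A A {S | S ⊆ T}, ∃ f₁ ∈ Finsupp.supported A A {S | S ⊆ T},
      f₀ + koszulWedge a f₁ = f ∧ koszulD r f₁ = 0 ∧ koszulD r f₀ = -(r a • f₁) := by
  have hnotMem : {S : Finset σ | S ⊆ T} ⊆ {S | a ∉ S} := fun S hS ha => (hT a (hS ha)).false
  have hD : ∀ {f : Finset σ →₀ A}, f ∈ Finsupp.supported A A {S | S ⊆ T} →
      koszulD r f ∈ Finsupp.supported A A {S | S ⊆ T} :=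
    koszulD_mem_supported r fun S hS i _ => (Finset.erase_subset i S).trans hS
  obtain ⟨f₀, h₀, f₁, h₁, rfl⟩ := exists_eq_add_koszulWedge hf
  obtain ⟨hd₀, hd₁⟩ : koszulD r f₀ + r a • f₁ = 0 ∧ -koszulD r f₁ = 0 := by
    refine eq_zero_of_add_koszulWedge_eq_zero (a := a)
      (Finsupp.supported_mono hnotMem (add_mem (hD h₀) (Submodule.smul_mem _ _ h₁)))
      (Finsupp.supported_mono hnotMem (neg_mem (hD h₁))) ?_
    rw [← hdf, map_add, koszulD_koszulWedge_of_subset r hT h₁, map_neg]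
    abel
  exact ⟨f₀, h₀, f₁, h₁, rfl, neg_eq_zero.1 hd₁, eq_neg_of_add_eq_zero_left hd₀⟩

/-- Exactness of the augmented Koszul complex of the subfamily of `r` indexed by `T`, in all
degrees at once: the condition on the coefficient of `∅` makes the augmentation vanish. -/
def KoszulExactOn (r : σ → A) (T : Finset σ) : Prop :=
  ∀ f ∈ Finsupp.supported A A {S | S ⊆ T}, koszulD r f = 0 → f ∅ ∈ Ideal.span (r '' T) →
    ∃ g ∈ Finsupp.supported A A {S | S ⊆ T}, koszulD r g = f

theorem koszulExactOn_empty (r : σ → A) : KoszulExactOn r ∅ := by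
  intro f hf _ hf₀
  refine ⟨0, zero_mem _, ?_⟩
  rw [map_zero, eq_comm]
  ext S
  by_cases hS : S = ∅
  · simpa [hS] using hf₀
  · exact Finsupp.notMem_support_iff.1 fun h => hS (Finset.subset_empty.1 (hf h))

theorem KoszulExactOn.insert_max {a : σ} {T : Finset σ} (h : KoszulExactOn r T)
    (hT : ∀ j ∈ T, j < a)
    (hra : ∀ x, r a * x ∈ Ideal.span (r '' T) → x ∈ Ideal.span (r '' T)) :
    KoszulExactOn r (insert a T) := by
  intro f hf hdf hf_empty
  obtain ⟨f₀, h₀, f₁, h₁, rfl, hd₁, hd₀⟩ :=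
    exists_eq_add_koszulWedge_of_koszulD_eq_zero hT hf hdf
  obtain ⟨g, hg, rfl⟩ : ∃ g ∈ Finsupp.supported A A {S | S ⊆ T}, koszulD r g = f₁ := by
    refine h f₁ h₁ hd₁ (hra _ ?_)
    rw [← smul_eq_mul, ← Finsupp.smul_apply, ← neg_eq_iff_eq_neg.2 hd₀, Finsupp.neg_apply]
    exact neg_mem (koszulD_apply_empty_mem_span h₀)
  obtain ⟨c, hc⟩ : ∃ c, f₀ ∅ + c * r a ∈ Ideal.span (r '' T) := by
    rw [Finsupp.add_apply, koszulWedge_apply_empty, add_zero, Finset.coe_insert,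
      Set.image_insert_eq] at hf_empty
    exact Submodule.mem_span_insert'.1 hf_empty
  have hmem_e : Finsupp.single ∅ (c - g ∅) ∈ Finsupp.supported A A {S | S ⊆ T} :=
    Finsupp.single_mem_supported A _ (Finset.empty_subset T)
  have hde : koszulD r (Finsupp.single ∅ (c - g ∅)) = 0 := by simp [koszulD_single]
  -- Modulo the boundary of `koszulWedge a (g + (c - g ∅) • ∅)`, the cycle only involves `T`.
  obtain ⟨g', hg', hdg'⟩ : ∃ g' ∈ Finsupp.supported A A {S | S ⊆ T},
      koszulD r g' = f₀ + r a • (g + Finsupp.single ∅ (c - g ∅)) := by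
    refine h _ (add_mem h₀ (Submodule.smul_mem _ _ (add_mem hg hmem_e))) ?_ ?_
    · rw [map_add, map_smul, map_add, hde, hd₀, add_zero, neg_add_cancel]
    · simpa [← add_mul, mul_comm (r a)] using hc
  refine ⟨g' - koszulWedge a (g + Finsupp.single ∅ (c - g ∅)), sub_mem
    (Finsupp.supported_mono (fun S hS => hS.trans (Finset.subset_insert a T)) hg')
    (koszulWedge_mem_supported (fun S hS => Finset.insert_subset_insert a hS)
      (add_mem hg hmem_e)), ?_⟩
  rw [map_sub, hdg', koszulD_koszulWedge_of_subset r hT (add_mem hg hmem_e), map_add (koszulD r),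
    hde, add_zero, sub_sub_eq_add_sub, add_sub_right_comm, add_sub_cancel_right]

theorem koszulExactOn_of_weaklyRegular (T : Finset σ)
    (hr : ∀ i ∈ T, ∀ x, r i * x ∈ Ideal.span (r '' {j ∈ T | j < i}) →
      x ∈ Ideal.span (r '' {j ∈ T | j < i})) : KoszulExactOn r T := by
  induction T using Finset.induction_on_max with
  | empty => exact koszulExactOn_empty r
  | insert a T hT ih =>
    have hbelow : ∀ i ∈ T, {j | j ∈ insert a T ∧ j < i} = {j | j ∈ T ∧ j < i} := fun i hi => by
      ext j
      simp only [Finset.mem_insert, Set.mem_ofPred_eq, and_congr_left_iff, or_iff_right_iff_imp]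
      rintro hj rfl
      exact absurd hj (hT i hi).not_gt
    have hbelow_a : {j | j ∈ insert a T ∧ j < a} = (T : Set σ) := by
      ext j
      simpa using ⟨by rintro ⟨rfl | h, h'⟩ <;> [exact absurd h' (lt_irrefl _); exact h],
        fun h => ⟨.inr h, hT j h⟩⟩
    refine (ih fun i hi x => ?_).insert_max hT fun x => ?_
    · exact hbelow i hi ▸ hr i (Finset.mem_insert_of_mem hi) x
    · exact hbelow_a ▸ hr a (Finset.mem_insert_self a T) x

end Acyclicity

section Grading

variable {σ : Type*} [LinearOrder σ] {A : Type*} [CommRing A]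

variable (σ A) in
/-- The degree `n` part of the Koszul complex, an `n`-th exterior power. -/
noncomputable def koszulChains (n : ℕ) : Submodule A (Finset σ →₀ A) :=
  Finsupp.supported A A {S | #S = n}

variable {n : ℕ} {f : Finset σ →₀ A}

theorem koszulD_mem_koszulChains (r : σ → A) (hf : f ∈ koszulChains σ A (n + 1)) :
    koszulD r f ∈ koszulChains σ A n :=
  koszulD_mem_supported r
    (fun S (hS : #S = n + 1) i hi => by simp [Finset.card_erase_of_mem hi, hS]) hf

theorem koszulD_eq_zero_of_mem_koszulChains_zero (r : σ → A) (hf : f ∈ koszulChains σ A 0) :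
    koszulD r f = 0 := by
  have h := koszulD_mem_supported r (t := ∅)
    (fun S (hS : #S = 0) i hi => by simp [Finset.card_eq_zero.1 hS] at hi) hf
  rwa [Finsupp.supported_empty, Submodule.mem_bot] at h

theorem koszulD_filter_card (r : σ → A) (n : ℕ) (f : Finset σ →₀ A) :
    koszulD r (f.filter (#· = n + 1)) = (koszulD r f).filter (#· = n) := by
  induction f using Finsupp.induction_linear with
  | zero => simp only [Finsupp.filter_zero, map_zero]
  | add f g hf hg => simp only [Finsupp.filter_add, map_add, hf, hg]
  | single S c =>
    have hcard : ∀ i ∈ S, (#(S.erase i) = n ↔ #S = n + 1) := fun i hi => by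
      rw [← Finset.card_erase_add_one hi, Nat.add_right_cancel_iff]
    rw [koszulD_single, Finsupp.filter_sum]
    by_cases hS : #S = n + 1
    · rw [Finsupp.filter_single_of_pos (#· = n + 1) hS, koszulD_single]
      exact Finset.sum_congr rfl fun i hi =>
        (Finsupp.filter_single_of_pos (#· = n) ((hcard i hi).2 hS)).symm
    · rw [Finsupp.filter_single_of_neg (#· = n + 1) hS, map_zero]
      exact (Finset.sum_eq_zero fun i hi =>
        Finsupp.filter_single_of_neg (#· = n) (mt (hcard i hi).1 hS)).symm

/-- A family is Koszul-regular if its Koszul homology vanishes in positive degrees. -/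
def IsKoszulRegular (r : σ → A) : Prop :=
  ∀ n, ∀ z ∈ koszulChains σ A (n + 1), koszulD r z = 0 →
    ∃ w ∈ koszulChains σ A (n + 2), koszulD r w = z

theorem isKoszulRegular_of_weaklyRegular [Finite σ] {r : σ → A}
    (hr : ∀ i x, r i * x ∈ Ideal.span (r '' Set.Iio i) → x ∈ Ideal.span (r '' Set.Iio i)) :
    IsKoszulRegular r := by
  intro n z hz hdz
  have := Fintype.ofFinite σ
  have hz_empty : z ∅ = 0 := Finsupp.notMem_support_iff.1 fun h => by simpa using hz h
  obtain ⟨g, -, hg⟩ := koszulExactOn_of_weaklyRegular (r := r) Finset.univ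
    (fun i _ x => by simpa [Set.Iio] using hr i x) z
    (fun S _ => Finset.subset_univ S) hdz (hz_empty ▸ zero_mem _)
  refine ⟨g.filter (#· = n + 2), (Finsupp.mem_supported _ _).2 fun S hS => ?_, ?_⟩
  · rw [Finsupp.support_filter, Finset.mem_coe, Finset.mem_filter] at hS
    exact hS.2
  · rw [koszulD_filter_card, hg, Finsupp.filter_eq_self_iff]
    exact fun S hS => hz (Finsupp.mem_support_iff.2 hS)

theorem isKoszulRegular_get {A : Type*} [CommRing A] {rs : List A}
    (hrs : RingTheory.Sequence.IsWeaklyRegular A rs) : IsKoszulRegular rs.get := by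
  refine isKoszulRegular_of_weaklyRegular fun i x hx => ?_
  have hset : Ideal.ofList (rs.take i) • (⊤ : Submodule A A) =
      Ideal.span (rs.get '' Set.Iio i) := by
    rw [smul_eq_mul, Ideal.mul_top, Ideal.ofList]
    congr 1
    ext y
    simp only [List.mem_take_iff_getElem, Set.mem_ofPred_eq, Set.mem_image, Set.mem_Iio,
      List.get_eq_getElem]
    exact ⟨fun ⟨j, hj, h⟩ => ⟨⟨j, by omega⟩, Fin.lt_def.2 (by simp; omega), h⟩,
      fun ⟨j, hj, h⟩ => ⟨j, by have := Fin.lt_def.1 hj; omega, h⟩⟩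
  rw [← hset, ← Submodule.Quotient.mk_eq_zero] at hx ⊢
  exact (isSMulRegular_iff_right_eq_zero_of_smul.1 (hrs.regular_mod_prev i i.2)) _ hx

end Grading

section PolynomialKoszul

open MvPolynomial

section Basis

variable {σ : Type*} {R : Type*} [CommRing R]

variable (σ R) in
/-- The basis over `R` of the polynomial Koszul complex by the products of an exterior monomial and
a monomial. -/
noncomputable def koszulBasis :
    Module.Basis (Finset σ × (σ →₀ ℕ)) R (Finset σ →₀ MvPolynomial σ R) :=
  (Finsupp.basis fun _ => basisMonomials σ R).reindex (Equiv.sigmaEquivProd _ _)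

@[simp]
theorem koszulBasis_apply (S : Finset σ) (α : σ →₀ ℕ) :
    koszulBasis σ R (S, α) = Finsupp.single S (monomial α 1) := by
  simp [koszulBasis]

variable (R) in
/-- The `R`-span of the basis vectors indexed by `W`. -/
noncomputable def koszulSpan (W : Set (Finset σ × (σ →₀ ℕ))) :
    Submodule R (Finset σ →₀ MvPolynomial σ R) :=
  Submodule.span R (koszulBasis σ R '' W)

theorem koszulSpan_le {W : Set (Finset σ × (σ →₀ ℕ))}
    {N : Submodule R (Finset σ →₀ MvPolynomial σ R)} :
    koszulSpan R W ≤ N ↔ ∀ S α, (S, α) ∈ W → Finsupp.single S (monomial α 1) ∈ N := by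
  simp only [koszulSpan, Submodule.span_le, Set.subset_def, Set.forall_mem_image, Prod.forall,
    koszulBasis_apply, SetLike.mem_coe]

theorem single_monomial_mem_koszulSpan {W : Set (Finset σ × (σ →₀ ℕ))} {S : Finset σ}
    {α : σ →₀ ℕ} (h : (S, α) ∈ W) : Finsupp.single S (monomial α 1) ∈ koszulSpan R W :=
  koszulSpan_le.1 le_rfl S α h

theorem koszulSpan_mono {W W' : Set (Finset σ × (σ →₀ ℕ))} (h : W ⊆ W') :
    koszulSpan R W ≤ koszulSpan R W' :=
  Submodule.span_mono (Set.image_mono h)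

instance koszulSpan_free (W : Set (Finset σ × (σ →₀ ℕ))) : Module.Free R (koszulSpan R W) := by
  rw [koszulSpan, Set.image_eq_range]
  exact .of_basis (.span ((koszulBasis σ R).linearIndependent.comp _ Subtype.val_injective))

theorem X_smul_single_monomial (i : σ) (S : Finset σ) (α : σ →₀ ℕ) :
    X (R := R) i • Finsupp.single S (monomial α (1 : R)) =
      Finsupp.single S (monomial (α + Finsupp.single i 1) 1) := by
  rw [Finsupp.smul_single, smul_eq_mul, monomial_add_single, pow_one, mul_comm]

theorem eqOn_koszulSpan {W : Set (Finset σ × (σ →₀ ℕ))} {M : Type*} [AddCommGroup M] [Module R M]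
    {φ ψ : (Finset σ →₀ MvPolynomial σ R) →ₗ[R] M}
    (h : ∀ S α, (S, α) ∈ W →
      φ (Finsupp.single S (monomial α 1)) = ψ (Finsupp.single S (monomial α 1))) :
    Set.EqOn φ ψ (koszulSpan R W) := by
  refine LinearMap.eqOn_span ?_
  rintro _ ⟨⟨S, α⟩, hp, rfl⟩
  rw [koszulBasis_apply]
  exact h S α hp

end Basis

variable {σ : Type*} [LinearOrder σ] {R : Type*} [CommRing R]

variable (σ R) in
/-- The differential of the polynomial Koszul complex. -/
noncomputable def polyKoszulD :
    (Finset σ →₀ MvPolynomial σ R) →ₗ[R] (Finset σ →₀ MvPolynomial σ R) :=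
  (koszulD X).restrictScalars R

theorem polyKoszulD_apply (F : Finset σ →₀ MvPolynomial σ R) :
    polyKoszulD σ R F = koszulD X F := rfl

theorem polyKoszulD_mem_koszulSpan {W W' : Set (Finset σ × (σ →₀ ℕ))}
    (h : ∀ S α, (S, α) ∈ W → ∀ i ∈ S, (S.erase i, α + Finsupp.single i 1) ∈ W')
    {F : Finset σ →₀ MvPolynomial σ R} (hF : F ∈ koszulSpan R W) :
    polyKoszulD σ R F ∈ koszulSpan R W' := by
  refine (koszulSpan_le (N := (koszulSpan R W').comap (polyKoszulD σ R))).2 (fun S α hS => ?_) hF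
  rw [Submodule.mem_comap, polyKoszulD_apply, koszulD_single]
  refine Submodule.sum_mem _ fun i hi => ?_
  have hterm : monomial α 1 * ((-1) ^ #{j ∈ S | i < j} * X i) =
      ((-1) ^ #{j ∈ S | i < j} : R) • monomial (α + Finsupp.single i 1) (1 : R) := by
    rw [monomial_add_single, pow_one, Algebra.smul_def]
    simp only [map_pow, map_neg, map_one]
    ring
  rw [hterm, ← Finsupp.smul_single]
  exact Submodule.smul_mem _ _ (single_monomial_mem_koszulSpan (h S α hS i hi))

variable (σ R) in
/-- The contraction of the polynomial Koszul complex that moves the largest variable of a monomial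
into the exterior factor when it exceeds all indices there, and is zero otherwise. -/
noncomputable def koszulHomotopy :
    (Finset σ →₀ MvPolynomial σ R) →ₗ[R] (Finset σ →₀ MvPolynomial σ R) :=
  (koszulBasis σ R).constr R fun p =>
    ∑ i ∈ p.2.support with (∀ j ∈ p.2.support, j ≤ i) ∧ ∀ j ∈ p.1, j < i,
      Finsupp.single (insert i p.1) (monomial (p.2 - Finsupp.single i 1) 1)

theorem koszulHomotopy_single (S : Finset σ) (α : σ →₀ ℕ) :
    koszulHomotopy σ R (Finsupp.single S (monomial α 1)) =
      ∑ i ∈ α.support with (∀ j ∈ α.support, j ≤ i) ∧ ∀ j ∈ S, j < i,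
        Finsupp.single (insert i S) (monomial (α - Finsupp.single i 1) 1) := by
  rw [← koszulBasis_apply, koszulHomotopy, Module.Basis.constr_basis]

/-- The index pairs whose exterior indices lie below `i` and whose variables lie weakly below
`i`. -/
def pairsBelow (i : σ) : Set (Finset σ × (σ →₀ ℕ)) :=
  {p | (∀ j ∈ p.1, j < i) ∧ ∀ j ∈ p.2.support, j ≤ i}

variable {i : σ} {F : Finset σ →₀ MvPolynomial σ R}

theorem polyKoszulD_mem_koszulSpan_pairsBelow (hF : F ∈ koszulSpan R (pairsBelow i)) :
    polyKoszulD σ R F ∈ koszulSpan R (pairsBelow i) := by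
  refine polyKoszulD_mem_koszulSpan (W := pairsBelow i) (W' := pairsBelow i)
    (fun S α ⟨hS, hα⟩ j hj => ⟨fun k hk => hS k (Finset.mem_of_mem_erase hk), fun k hk => ?_⟩) hF
  rcases Finset.mem_union.1 (Finsupp.support_add hk) with hk | hk
  · exact hα k hk
  · rw [Finset.mem_singleton.1 (Finsupp.support_single_subset hk)]
    exact (hS j hj).le

theorem koszulHomotopy_X_smul (hF : F ∈ koszulSpan R (pairsBelow i)) :
    koszulHomotopy σ R (X (R := R) i • F) = koszulWedge i F := by
  refine eqOn_koszulSpan (W := pairsBelow i)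
    (φ := koszulHomotopy σ R ∘ₗ Algebra.lsmul R R _ (X (R := R) i))
    (ψ := (koszulWedge i).restrictScalars R) (fun S α ⟨hS, hα⟩ => ?_) hF
  have hmax : ({k ∈ (α + Finsupp.single i 1).support |
      (∀ j ∈ (α + Finsupp.single i 1).support, j ≤ k) ∧ ∀ j ∈ S, j < k} : Finset σ) = {i} := by
    have hsupp : ∀ k ∈ (α + Finsupp.single i 1).support, k ≤ i := fun k hk => by
      rcases Finset.mem_union.1 (Finsupp.support_add hk) with hk | hk
      · exact hα k hk
      · exact (Finset.mem_singleton.1 (Finsupp.support_single_subset hk)).le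
    have hi : i ∈ (α + Finsupp.single i 1).support := Finsupp.mem_support_iff.2 (by simp)
    ext k
    simp only [Finset.mem_filter, Finset.mem_singleton]
    exact ⟨fun h => (hsupp k h.1).antisymm (h.2.1 i hi), by rintro rfl; exact ⟨hi, hsupp, hS⟩⟩
  simp only [LinearMap.comp_apply, Algebra.lsmul_coe, LinearMap.restrictScalars_apply,
    X_smul_single_monomial, koszulHomotopy_single, hmax, Finset.sum_singleton, koszulWedge_single,
    add_tsub_cancel_right]

theorem koszulHomotopy_koszulWedge (hF : F ∈ koszulSpan R (pairsBelow i)) :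
    koszulHomotopy σ R (koszulWedge i F) = 0 := by
  refine eqOn_koszulSpan (W := pairsBelow i)
    (φ := koszulHomotopy σ R ∘ₗ (koszulWedge i).restrictScalars R) (ψ := 0)
    (fun S α ⟨_, hα⟩ => ?_) hF
  change koszulHomotopy σ R (koszulWedge i (Finsupp.single S (monomial α 1))) = 0
  rw [koszulWedge_single, koszulHomotopy_single, Finset.filter_false_of_mem, Finset.sum_empty]
  exact fun j hj h => (h.2 i (Finset.mem_insert_self i S)).not_ge (hα j hj)

theorem polyKoszulD_koszulWedge (hF : F ∈ koszulSpan R (pairsBelow i)) :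
    polyKoszulD σ R (koszulWedge i F) = X (R := R) i • F - koszulWedge i (polyKoszulD σ R F) := by
  refine koszulD_koszulWedge X ?_
  refine (koszulSpan_le (N := (Finsupp.supported (MvPolynomial σ R) (MvPolynomial σ R)
    {S | ∀ j ∈ S, j < i}).restrictScalars R)).2 (fun S α h => ?_) hF
  exact Finsupp.single_mem_supported _ _ h.1

theorem exists_eq_X_smul_or_eq_koszulWedge {S : Finset σ} {α : σ →₀ ℕ} (h : (S, α) ≠ (∅, 0)) :
    ∃ i, ∃ F ∈ koszulSpan R (pairsBelow i), Finsupp.single S (monomial α 1) = X (R := R) i • F ∨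
      Finsupp.single S (monomial α 1) = koszulWedge i F := by
  have hne : (S ∪ α.support).Nonempty := by
    rw [Finset.nonempty_iff_ne_empty]
    simpa [Prod.ext_iff] using h
  obtain ⟨i, hi, hmax⟩ := (S ∪ α.support).exists_max_image id hne
  have hS : ∀ j ∈ S, j ≤ i := fun j hj => hmax j (Finset.mem_union_left _ hj)
  have hα : ∀ j ∈ α.support, j ≤ i := fun j hj => hmax j (Finset.mem_union_right _ hj)
  by_cases hiS : i ∈ S
  · refine ⟨i, Finsupp.single (S.erase i) (monomial α 1), single_monomial_mem_koszulSpan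
      ⟨fun j hj => ?_, hα⟩, .inr ?_⟩
    · exact (hS j (Finset.mem_of_mem_erase hj)).lt_of_ne (Finset.ne_of_mem_erase hj)
    · rw [koszulWedge_single, Finset.insert_erase hiS]
  · have hiα : i ∈ α.support := (Finset.mem_union.1 hi).resolve_left hiS
    refine ⟨i, Finsupp.single S (monomial (α - Finsupp.single i 1) 1),
      single_monomial_mem_koszulSpan ⟨fun j hj => (hS j hj).lt_of_ne ?_, fun j hj => ?_⟩, .inl ?_⟩
    · rintro rfl
      exact hiS hj
    · exact hα j (Finsupp.support_tsub hj)
    · rw [X_smul_single_monomial, tsub_add_cancel_of_le]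
      rwa [Finsupp.single_le_iff, Nat.one_le_iff_ne_zero, ← Finsupp.mem_support_iff]

theorem polyKoszulD_koszulHomotopy_add (hF : F ∈ koszulSpan R {(∅, 0)}ᶜ) :
    polyKoszulD σ R (koszulHomotopy σ R F) + koszulHomotopy σ R (polyKoszulD σ R F) = F := by
  refine eqOn_koszulSpan (W := {(∅, 0)}ᶜ) (φ := polyKoszulD σ R ∘ₗ koszulHomotopy σ R +
    koszulHomotopy σ R ∘ₗ polyKoszulD σ R) (ψ := LinearMap.id) (fun S α h => ?_) hF
  rw [LinearMap.add_apply, LinearMap.comp_apply, LinearMap.comp_apply, LinearMap.id_apply]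
  obtain ⟨i, F, hF, hX | hW⟩ := exists_eq_X_smul_or_eq_koszulWedge (R := R) h
  · have hdX : polyKoszulD σ R (X (R := R) i • F) = X (R := R) i • polyKoszulD σ R F :=
      map_smul (koszulD X) _ _
    rw [hX, hdX, koszulHomotopy_X_smul hF, polyKoszulD_koszulWedge hF,
      koszulHomotopy_X_smul (polyKoszulD_mem_koszulSpan_pairsBelow hF), sub_add_cancel]
  · rw [hW, koszulHomotopy_koszulWedge hF, polyKoszulD_koszulWedge hF, map_zero, map_sub,
      koszulHomotopy_X_smul hF,
      koszulHomotopy_koszulWedge (polyKoszulD_mem_koszulSpan_pairsBelow hF), sub_zero, zero_add]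

end PolynomialKoszul

section Strands

open MvPolynomial

variable {σ : Type*} {R : Type*} [CommRing R]

variable (σ R) in
/-- The part of the polynomial Koszul complex in exterior degree `n` and polynomial degree `t`. -/
noncomputable def koszulStrand (n t : ℕ) : Submodule R (Finset σ →₀ MvPolynomial σ R) :=
  koszulSpan R {p | #p.1 = n ∧ p.2.degree = t}

variable {n t : ℕ} {F : Finset σ →₀ MvPolynomial σ R}

theorem single_mem_koszulStrand {S : Finset σ} (hS : #S = n) {p : MvPolynomial σ R}
    (hp : p.IsHomogeneous t) : Finsupp.single S p ∈ koszulStrand σ R n t := by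
  rw [p.as_sum, ← Finsupp.lsingle_apply (R := R), map_sum]
  refine Submodule.sum_mem _ fun α hα => ?_
  rw [Finsupp.lsingle_apply, ← mul_one (coeff α p), ← smul_eq_mul, ← smul_monomial,
    ← Finsupp.smul_single]
  exact Submodule.smul_mem _ _ (single_monomial_mem_koszulSpan
    ⟨hS, (hp.degree_eq_sum_deg_support hα).symm⟩)

theorem koszulStrand_le_koszulSpan_compl (h : n ≠ 0 ∨ t ≠ 0) :
    koszulStrand σ R n t ≤ koszulSpan R {(∅, 0)}ᶜ := by
  refine koszulSpan_mono ?_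
  rintro _ ⟨hn, ht⟩ rfl
  rcases h with h | h
  exacts [h hn.symm, h (ht.symm.trans (map_zero _))]

variable [LinearOrder σ]

variable (σ R) in
/-- The complement of the boundaries in `koszulStrand σ R (n + 1) t` onto which `koszulHomotopy`
projects: it is spanned by the basis vectors whose largest index is exterior. -/
noncomputable def koszulReducedStrand (n t : ℕ) : Submodule R (Finset σ →₀ MvPolynomial σ R) :=
  koszulSpan R {p | #p.1 = n + 1 ∧ p.2.degree = t ∧
    ∃ i ∈ p.1, (∀ j ∈ p.1, j ≤ i) ∧ ∀ j ∈ p.2.support, j ≤ i}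

instance koszulReducedStrand_free (n t : ℕ) : Module.Free R (koszulReducedStrand σ R n t) :=
  koszulSpan_free _

theorem koszulReducedStrand_le : koszulReducedStrand σ R n t ≤ koszulStrand σ R (n + 1) t :=
  koszulSpan_mono fun _ h => ⟨h.1, h.2.1⟩

theorem polyKoszulD_mem_koszulStrand (hF : F ∈ koszulStrand σ R (n + 1) t) :
    polyKoszulD σ R F ∈ koszulStrand σ R n (t + 1) :=
  polyKoszulD_mem_koszulSpan (W' := {p | #p.1 = n ∧ p.2.degree = t + 1})
    (fun S α (h : #S = n + 1 ∧ α.degree = t) i hi =>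
      ⟨by simp [Finset.card_erase_of_mem hi, h.1], by simp [h.2]⟩) hF

theorem koszulHomotopy_mem_koszulReducedStrand (hF : F ∈ koszulStrand σ R n (t + 1)) :
    koszulHomotopy σ R F ∈ koszulReducedStrand σ R n t := by
  refine (koszulSpan_le (N := (koszulReducedStrand σ R n t).comap (koszulHomotopy σ R))).2
    (fun S α (h : #S = n ∧ α.degree = t + 1) => ?_) hF
  rw [Submodule.mem_comap, koszulHomotopy_single]
  refine Submodule.sum_mem _ fun i hi => single_monomial_mem_koszulSpan ?_
  obtain ⟨hi, hmax, hlt⟩ := Finset.mem_filter.1 hi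
  have hle : Finsupp.single i 1 ≤ α := by
    rwa [Finsupp.single_le_iff, Nat.one_le_iff_ne_zero, ← Finsupp.mem_support_iff]
  refine ⟨?_, ?_, i, Finset.mem_insert_self i S, fun j hj => ?_, fun j hj =>
    hmax j (Finsupp.support_tsub hj)⟩
  · rw [Finset.card_insert_of_notMem fun h => (hlt i h).false, h.1]
  · have hdeg := congrArg Finsupp.degree (tsub_add_cancel_of_le hle)
    rw [map_add, Finsupp.degree_single, h.2] at hdeg
    exact Nat.add_right_cancel hdeg
  · rcases Finset.mem_insert.1 hj with rfl | hj
    exacts [le_rfl, (hlt j hj).le]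

theorem koszulHomotopy_eq_zero (hF : F ∈ koszulReducedStrand σ R n t) :
    koszulHomotopy σ R F = 0 := by
  refine eqOn_koszulSpan (ψ := 0) ?_ hF
  rintro S α ⟨_, _, i, hi, _, hα⟩
  rw [koszulHomotopy_single, Finset.filter_false_of_mem, Finset.sum_empty, LinearMap.zero_apply]
  exact fun j hj h => (h.2 i hi).not_ge (hα j hj)

theorem polyKoszulD_polyKoszulD (F : Finset σ →₀ MvPolynomial σ R) :
    polyKoszulD σ R (polyKoszulD σ R F) = 0 :=
  koszulD_koszulD X F

theorem koszulHomotopy_polyKoszulD (hF : F ∈ koszulReducedStrand σ R n t) :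
    koszulHomotopy σ R (polyKoszulD σ R F) = F := by
  have h := polyKoszulD_koszulHomotopy_add
    (koszulStrand_le_koszulSpan_compl (.inl n.succ_ne_zero) (koszulReducedStrand_le hF))
  rwa [koszulHomotopy_eq_zero hF, map_zero, zero_add] at h

theorem polyKoszulD_koszulHomotopy (hF : F ∈ koszulStrand σ R n (t + 1))
    (hdF : polyKoszulD σ R F = 0) : polyKoszulD σ R (koszulHomotopy σ R F) = F := by
  have h := polyKoszulD_koszulHomotopy_add
    (koszulStrand_le_koszulSpan_compl (.inr t.succ_ne_zero) hF)
  rwa [hdF, map_zero, add_zero] at h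

theorem polyKoszulD_eq_zero (hF : F ∈ koszulStrand σ R 0 t) : polyKoszulD σ R F = 0 := by
  refine eqOn_koszulSpan (ψ := 0) ?_ hF
  rintro S α ⟨hS, _⟩
  obtain rfl := Finset.card_eq_zero.1 hS
  rw [polyKoszulD_apply, koszulD_single, Finset.sum_empty, LinearMap.zero_apply]

end Strands

section Evaluation

open MvPolynomial

variable {σ : Type*} {R : Type*} [CommRing R]

/-- Evaluation of the coefficients of the polynomial Koszul complex at a family of ring elements. -/
noncomputable def koszulEval (r : σ → R) :
    (Finset σ →₀ MvPolynomial σ R) →ₗ[R] (Finset σ →₀ R) :=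
  Finsupp.mapRange.linearMap (aeval r).toLinearMap

@[simp]
theorem koszulEval_single (r : σ → R) (S : Finset σ) (p : MvPolynomial σ R) :
    koszulEval r (Finsupp.single S p) = Finsupp.single S (aeval r p) :=
  Finsupp.mapRange_single (hf := map_zero _)

theorem koszulEval_apply (r : σ → R) (F : Finset σ →₀ MvPolynomial σ R) (S : Finset σ) :
    koszulEval r F S = aeval r (F S) := rfl

theorem card_of_mem_support_of_mem_koszulStrand {n t : ℕ} {F : Finset σ →₀ MvPolynomial σ R}
    (hF : F ∈ koszulStrand σ R n t) {S : Finset σ} (hS : S ∈ F.support) : #S = n := by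
  refine koszulSpan_le (N := (Finsupp.supported (MvPolynomial σ R) (MvPolynomial σ R)
    {S | #S = n}).restrictScalars R) |>.2 (fun S α h => ?_) hF hS
  exact Finsupp.single_mem_supported _ _ h.1

theorem apply_isHomogeneous_of_mem_koszulStrand {n t : ℕ} {F : Finset σ →₀ MvPolynomial σ R}
    (S : Finset σ) (hF : F ∈ koszulStrand σ R n t) : (F S).IsHomogeneous t := by
  refine koszulSpan_le (N := (homogeneousSubmodule σ R t).comap (Finsupp.lapply S)) |>.2
    (fun S' α h => ?_) hF
  classical
  rw [Submodule.mem_comap, Finsupp.lapply_apply, Finsupp.single_apply]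
  split_ifs
  exacts [isHomogeneous_monomial 1 h.2, zero_mem _]

variable {r : σ → R} {I : Ideal R}

theorem map_koszulEval_koszulStrand (hI : I = Ideal.span (Set.range r)) (n t : ℕ) :
    (koszulStrand σ R n t).map (koszulEval r) = I ^ t • koszulChains σ R n := by
  subst hI
  refine le_antisymm (Submodule.map_le_iff_le_comap.2 (koszulSpan_le.2 fun S α h => ?_))
    (Submodule.smul_le.2 fun c hc => ?_)
  · rw [Submodule.mem_comap, koszulEval_single, ← mul_one (aeval r _), ← smul_eq_mul,
      ← Finsupp.smul_single]
    exact Submodule.smul_mem_smul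
      ((Ideal.mem_span_pow_iff_exists_isHomogeneous r _).2
        ⟨monomial α 1, isHomogeneous_monomial 1 h.2, (aeval_eq_eval r ▸ rfl)⟩)
      (Finsupp.single_mem_supported R 1 h.1)
  · obtain ⟨p, hp, rfl⟩ := (Ideal.mem_span_pow_iff_exists_isHomogeneous r c).1 hc
    rw [koszulChains, Finsupp.supported_eq_span_single]
    refine Submodule.span_le (p := ((koszulStrand σ R n t).map (koszulEval r)).comap
      (LinearMap.lsmul R _ (eval r p))) |>.2 ?_
    rintro _ ⟨S, hS, rfl⟩
    refine ⟨Finsupp.single S p, single_mem_koszulStrand hS hp, ?_⟩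
    simp [aeval_eq_eval]

theorem map_koszulEval_smul_koszulStrand (hI : I = Ideal.span (Set.range r)) (n t : ℕ) :
    (I • koszulStrand σ R n t).map (koszulEval r) = I ^ (t + 1) • koszulChains σ R n := by
  rw [Submodule.map_smul'', map_koszulEval_koszulStrand hI, ← Submodule.mul_smul, pow_succ']

variable [LinearOrder σ]

theorem koszulD_koszulEval (r : σ → R) (F : Finset σ →₀ MvPolynomial σ R) :
    koszulD r (koszulEval r F) = koszulEval r (polyKoszulD σ R F) := by
  rw [polyKoszulD_apply, koszulEval, ← koszulD_mapRange]
  congr 2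
  exact funext fun i => (aeval_X r i).symm

theorem koszulD_mem_smul_koszulChains (hI : I = Ideal.span (Set.range r)) {n : ℕ}
    {w : Finset σ →₀ R} (hw : w ∈ koszulChains σ R (n + 1)) :
    koszulD r w ∈ I • koszulChains σ R n := by
  rw [← one_smul (Ideal R) (koszulChains σ R (n + 1)), ← pow_zero I,
    ← map_koszulEval_koszulStrand hI] at hw
  obtain ⟨V, hV, rfl⟩ := hw
  rw [koszulD_koszulEval, ← pow_one I, ← map_koszulEval_koszulStrand hI]
  exact Submodule.mem_map_of_mem (polyKoszulD_mem_koszulStrand hV)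

end Evaluation

theorem map_mem_ideal_smul {R M N : Type*} [CommRing R] [AddCommGroup M] [Module R M]
    [AddCommGroup N] [Module R N] (I : Ideal R) (φ : M →ₗ[R] N) {P : Submodule R M}
    {Q : Submodule R N} (h : ∀ x ∈ P, φ x ∈ Q) {x : M} (hx : x ∈ I • P) : φ x ∈ I • Q :=
  Submodule.smul_mono le_rfl (Submodule.map_le_iff_le_comap.2 h)
    ((Submodule.map_smul'' I P φ).le (Submodule.mem_map_of_mem hx))

section QuasiRegularity

open MvPolynomial

variable {σ : Type*} {R : Type*} [CommRing R]

/-- Quasi-regularity of a family in degree `t`: the forms of degree `t` that vanish on the family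
have coefficients in the ideal it generates. -/
def IsQuasiRegularInDegree (r : σ → R) (t : ℕ) : Prop :=
  ∀ p : MvPolynomial σ R, p.IsHomogeneous t → aeval r p = 0 →
    p ∈ Ideal.span (Set.range r) • homogeneousSubmodule σ R t

theorem isQuasiRegularInDegree_zero (r : σ → R) : IsQuasiRegularInDegree r 0 := by
  intro p hp h
  obtain ⟨a, rfl⟩ : ∃ a, p = C a :=
    ⟨_, totalDegree_eq_zero_iff_eq_C.1 (Nat.le_zero.1 hp.totalDegree_le)⟩
  rw [aeval_C, Algebra.algebraMap_self_apply] at h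
  rw [h, map_zero]
  exact zero_mem _

variable {r : σ → R} {I : Ideal R} {n t : ℕ} {F : Finset σ →₀ MvPolynomial σ R}

theorem IsQuasiRegularInDegree.mem_smul_koszulStrand (hq : IsQuasiRegularInDegree r t)
    (hI : I = Ideal.span (Set.range r)) (hF : F ∈ koszulStrand σ R n t)
    (h : koszulEval r F ∈ I ^ (t + 1) • koszulChains σ R n) : F ∈ I • koszulStrand σ R n t := by
  suffices hzero : ∀ F ∈ koszulStrand σ R n t, koszulEval r F = 0 → F ∈ I • koszulStrand σ R n t by
    obtain ⟨G, hG, hGF⟩ := (map_koszulEval_smul_koszulStrand hI n t).ge h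
    rw [← sub_add_cancel F G]
    exact add_mem (hzero _ (sub_mem hF (Submodule.smul_le_right hG))
      (by rw [map_sub, hGF, sub_self])) hG
  intro F hF hF0
  rw [← F.sum_single]
  refine Submodule.sum_mem _ fun S hS => ?_
  have hFS : F S ∈ I • homogeneousSubmodule σ R t :=
    hI ▸ hq (F S) (apply_isHomogeneous_of_mem_koszulStrand S hF)
      (by rw [← koszulEval_apply, hF0, Finsupp.zero_apply])
  exact map_mem_ideal_smul I (Finsupp.lsingle S) (fun p hp =>
    single_mem_koszulStrand (card_of_mem_support_of_mem_koszulStrand hF hS) hp) hFS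

variable [LinearOrder σ]

theorem exists_koszulReducedStrand_koszulD_eq (hI : I = Ideal.span (Set.range r))
    {w : Finset σ →₀ R} (hw : w ∈ I ^ t • koszulChains σ R (n + 1)) :
    ∃ W ∈ koszulReducedStrand σ R n t, koszulD r (koszulEval r W) = koszulD r w := by
  obtain ⟨V, hV, rfl⟩ := (map_koszulEval_koszulStrand hI (n + 1) t).ge hw
  have hdV := polyKoszulD_mem_koszulStrand hV
  refine ⟨_, koszulHomotopy_mem_koszulReducedStrand hdV, ?_⟩
  rw [koszulD_koszulEval, koszulD_koszulEval,
    polyKoszulD_koszulHomotopy hdV (polyKoszulD_polyKoszulD V)]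

theorem mem_smul_koszulReducedStrand (hF : F ∈ koszulReducedStrand σ R n t)
    (h : polyKoszulD σ R F ∈ I • koszulStrand σ R n (t + 1)) :
    F ∈ I • koszulReducedStrand σ R n t := by
  rw [← koszulHomotopy_polyKoszulD hF]
  exact map_mem_ideal_smul I _ (fun _ => koszulHomotopy_mem_koszulReducedStrand) h

theorem polyKoszulD_mem_smul_koszulStrand (hF : F ∈ I • koszulStrand σ R (n + 1) t) :
    polyKoszulD σ R F ∈ I • koszulStrand σ R n (t + 1) :=
  map_mem_ideal_smul I _ (fun _ => polyKoszulD_mem_koszulStrand) hF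

theorem exists_koszulReducedStrand_of_koszulD_eq_zero (hr : IsKoszulRegular r)
    (hI : I = Ideal.span (Set.range r)) (hq : ∀ k ≤ t, IsQuasiRegularInDegree r k)
    {z : Finset σ →₀ R} (hz : z ∈ I ^ (t + 1) • koszulChains σ R n) (hdz : koszulD r z = 0) :
    ∃ W ∈ koszulReducedStrand σ R n t, koszulD r (koszulEval r W) = z := by
  induction t with
  | zero =>
    rcases n with - | n
    · rw [zero_add, ← map_koszulEval_koszulStrand hI] at hz
      obtain ⟨Z, hZ, rfl⟩ := hz
      refine ⟨_, koszulHomotopy_mem_koszulReducedStrand hZ, ?_⟩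
      rw [koszulD_koszulEval, polyKoszulD_koszulHomotopy hZ (polyKoszulD_eq_zero hZ)]
    · obtain ⟨w, hw, rfl⟩ := hr n z (Submodule.smul_le_right hz) hdz
      exact exists_koszulReducedStrand_koszulD_eq hI (by simpa using hw)
  | succ t ih =>
    have hz' : z ∈ I ^ (t + 1) • koszulChains σ R n :=
      Submodule.smul_mono_left (Ideal.pow_le_pow_right (Nat.le_succ _)) hz
    obtain ⟨W, hW, rfl⟩ := ih (fun k hk => hq k (hk.trans t.le_succ)) hz'
    rw [koszulD_koszulEval] at hz
    have hW' := mem_smul_koszulReducedStrand hW ((hq (t + 1) le_rfl).mem_smul_koszulStrand hI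
      (polyKoszulD_mem_koszulStrand (koszulReducedStrand_le hW)) hz)
    refine exists_koszulReducedStrand_koszulD_eq hI ?_
    rw [← map_koszulEval_smul_koszulStrand hI]
    exact Submodule.mem_map_of_mem (Submodule.smul_mono le_rfl koszulReducedStrand_le hW')

theorem IsKoszulRegular.isQuasiRegularInDegree (hr : IsKoszulRegular r) (t : ℕ) :
    IsQuasiRegularInDegree r t := by
  induction t using Nat.strong_induction_on with
  | h t ih =>
  rcases t with - | t
  · exact isQuasiRegularInDegree_zero r
  intro p hp hp0
  have hF : Finsupp.single ∅ p ∈ koszulStrand σ R 0 (t + 1) :=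
    single_mem_koszulStrand Finset.card_empty hp
  have hhF := koszulReducedStrand_le (koszulHomotopy_mem_koszulReducedStrand hF)
  have hdhF := polyKoszulD_koszulHomotopy hF (polyKoszulD_eq_zero hF)
  suffices ∃ G ∈ Ideal.span (Set.range r) • koszulStrand σ R 1 t,
      polyKoszulD σ R G = Finsupp.single ∅ p by
    obtain ⟨G, hG, hGp⟩ := this
    have hdG := polyKoszulD_mem_smul_koszulStrand hG
    rw [hGp] at hdG
    simpa using map_mem_ideal_smul _ (Finsupp.lapply ∅)
      (fun _ => apply_isHomogeneous_of_mem_koszulStrand ∅) hdG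
  have hcycle : koszulD r (koszulEval r (koszulHomotopy σ R (Finsupp.single ∅ p))) = 0 := by
    rw [koszulD_koszulEval, hdhF, koszulEval_single, hp0, Finsupp.single_zero]
  rcases t with - | t
  · obtain ⟨w, hw, hdw⟩ := hr 0 _ (by
      simpa using (map_koszulEval_koszulStrand rfl 1 0).le (Submodule.mem_map_of_mem hhF)) hcycle
    refine ⟨_, (ih 0 zero_lt_one).mem_smul_koszulStrand rfl hhF ?_, hdhF⟩
    rw [← hdw, zero_add, pow_one]
    exact koszulD_mem_smul_koszulChains rfl hw
  · obtain ⟨W, hW, hdW⟩ := exists_koszulReducedStrand_of_koszulD_eq_zero hr rfl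
      (fun k hk => ih k (by omega)) ((map_koszulEval_koszulStrand rfl 1 (t + 1)).le
        (Submodule.mem_map_of_mem hhF)) hcycle
    refine ⟨koszulHomotopy σ R (Finsupp.single ∅ p) - polyKoszulD σ R W,
      (ih (t + 1) (Nat.lt_succ_self _)).mem_smul_koszulStrand rfl (sub_mem hhF
        (polyKoszulD_mem_koszulStrand (koszulReducedStrand_le hW))) ?_, ?_⟩
    · rw [map_sub, ← koszulD_koszulEval, hdW, sub_self]
      exact zero_mem _
    · rw [map_sub, polyKoszulD_polyKoszulD, hdhF, sub_zero]

theorem IsKoszulRegular.koszulD_koszulEval_mem_map_iff (hr : IsKoszulRegular r)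
    (hI : I = Ideal.span (Set.range r)) {W : Finset σ →₀ MvPolynomial σ R}
    (hW : W ∈ koszulReducedStrand σ R n t) :
    koszulD r (koszulEval r W) ∈ (I ^ (t + 1) • koszulChains σ R (n + 1)).map (koszulD r) ↔
      W ∈ I • koszulReducedStrand σ R n t := by
  rw [← map_koszulEval_smul_koszulStrand hI]
  constructor
  · rintro ⟨_, ⟨V, hV, rfl⟩, hVW⟩
    have hdW := polyKoszulD_mem_koszulStrand (koszulReducedStrand_le hW)
    have hdV := polyKoszulD_mem_smul_koszulStrand hV
    refine mem_smul_koszulReducedStrand hW ?_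
    rw [← sub_add_cancel (polyKoszulD σ R W) (polyKoszulD σ R V)]
    refine add_mem ((hr.isQuasiRegularInDegree (t + 1)).mem_smul_koszulStrand hI
      (sub_mem hdW (Submodule.smul_le_right hdV)) ?_) hdV
    rw [map_sub, ← koszulD_koszulEval, ← koszulD_koszulEval, hVW, sub_self]
    exact zero_mem _
  · exact fun h => Submodule.mem_map_of_mem (Submodule.mem_map_of_mem
      (Submodule.smul_mono le_rfl koszulReducedStrand_le h))

end QuasiRegularity

section FreeReduction

variable {R : Type*} [CommRing R] {I : Ideal R}

theorem free_of_ker_eq_smul_top {Q T : Type*} [AddCommGroup Q] [Module R Q] [Module.Free R Q]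
    [AddCommGroup T] [Module R T] [Module (R ⧸ I) T] [IsScalarTower R (R ⧸ I) T]
    (φ : Q →ₗ[R] T) (hφ : Function.Surjective φ) (hker : LinearMap.ker φ = I • ⊤) :
    Module.Free (R ⧸ I) T :=
  .of_equiv ((TensorProduct.quotTensorEquivQuotSMul Q I ≪≫ₗ
    Submodule.quotEquivOfEq _ _ hker.symm ≪≫ₗ
    φ.quotKerEquivOfSurjective hφ).extendScalarsOfSurjective Ideal.Quotient.mk_surjective)

theorem free_of_exact {A M N P : Type*} [Ring A] [AddCommGroup M] [AddCommGroup N]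
    [AddCommGroup P] [Module A M] [Module A N] [Module A P] [Module.Free A M] [Module.Free A P]
    {f : M →ₗ[A] N} {g : N →ₗ[A] P} (hf : Function.Injective f) (hfg : Function.Exact f g)
    (hg : Function.Surjective g) : Module.Free A N := by
  obtain ⟨l, hl⟩ := Module.projective_lifting_property g LinearMap.id hg
  exact .of_equiv (hfg.splitSurjectiveEquiv hf ⟨l, hl⟩).1.symm

end FreeReduction

section Homology

variable {R : Type u} [CommRing R] (C : ChainComplex (ModuleCat.{u} R) ℕ) (n : ℕ)

theorem homologyπ_surjective : Function.Surjective (C.homologyπ n) :=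
  (ModuleCat.epi_iff_surjective _).1 inferInstance

theorem iCycles_injective : Function.Injective (C.iCycles n) :=
  (ModuleCat.mono_iff_injective _).1 inferInstance

theorem homologyπ_eq_zero_iff (z : C.cycles n) :
    C.homologyπ n z = 0 ↔ ∃ y, C.d (n + 1) n y = C.iCycles n z := by
  have hexact := (ShortComplex.ShortExact.moduleCat_exact_iff_function_exact _).1
    (ShortComplex.exact_of_g_is_cokernel (ShortComplex.mk _ _
      (C.toCycles_comp_homologyπ (n + 1) n)) (C.homologyIsCokernel (n + 1) n (by simp)))
  refine (hexact z).trans (exists_congr fun y => ?_)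
  rw [← (iCycles_injective C n).eq_iff]
  exact Eq.congr_left (congrArg (fun φ => φ.hom y) (C.toCycles_i (n + 1) n))

theorem exists_iCycles_eq {x : C.X n} (hx : ∀ j, C.d n j x = 0) : ∃ z, C.iCycles n z = x :=
  ((ShortComplex.ShortExact.moduleCat_exact_iff_function_exact _).1
    (ShortComplex.exact_of_f_is_kernel (ShortComplex.mk _ _ (C.iCycles_d n _))
      (C.cyclesIsKernel n _ rfl)) x).1 (hx _)

theorem d_iCycles (z : C.cycles n) (j : ℕ) : C.d n j (C.iCycles n z) = 0 :=
  congrArg (fun φ => φ.hom z) (C.iCycles_d n j)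

variable {C n} {D : ChainComplex (ModuleCat.{u} R) ℕ} (f : C ⟶ D)

theorem iCycles_cyclesMap (z : C.cycles n) :
    D.iCycles n (HomologicalComplex.cyclesMap f n z) = f.f n (C.iCycles n z) :=
  congrArg (fun φ => φ.hom z) (HomologicalComplex.cyclesMap_i f n)

theorem homologyMap_homologyπ (z : C.cycles n) :
    HomologicalComplex.homologyMap f n (C.homologyπ n z) =
      D.homologyπ n (HomologicalComplex.cyclesMap f n z) :=
  congrArg (fun φ => φ.hom z) (HomologicalComplex.homologyπ_naturality f n)

theorem homologyMap_eq_zero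
    (hf : ∀ x, (∀ j, C.d n j x = 0) → ∃ y, D.d (n + 1) n y = f.f n x) :
    HomologicalComplex.homologyMap f n = 0 := by
  ext h
  obtain ⟨z, rfl⟩ := homologyπ_surjective C n h
  refine (homologyMap_homologyπ f z).trans ((homologyπ_eq_zero_iff D n _).2 ?_)
  rw [iCycles_cyclesMap]
  exact hf _ (d_iCycles C n z)

theorem homologyMap_zero_surjective (hf : Function.Surjective (f.f 0)) :
    Function.Surjective (HomologicalComplex.homologyMap f 0) := by
  intro h
  obtain ⟨z, rfl⟩ := homologyπ_surjective D 0 h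
  obtain ⟨x, hx⟩ := hf (D.iCycles 0 z)
  obtain ⟨w, rfl⟩ := exists_iCycles_eq C 0 (x := x) fun j => by
    rw [C.shape _ _ (by simp)]
    rfl
  refine ⟨C.homologyπ 0 w, (homologyMap_homologyπ f w).trans (congrArg _ ?_)⟩
  exact iCycles_injective D 0 ((iCycles_cyclesMap f w).trans hx)

theorem free_of_homology {I : Ideal R} {T : Type*} [AddCommGroup T] [Module R T]
    [Module (R ⧸ I) T] [IsScalarTower R (R ⧸ I) T] (e : T ≃ₗ[R] C.homology n) {Q : Type u}
    [AddCommGroup Q] [Module R Q] [Module.Free R Q] (ψ : Q →ₗ[R] C.X n)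
    (hψ : ∀ q j, C.d n j (ψ q) = 0)
    (hsurj : ∀ x, (∀ j, C.d n j x = 0) → ∃ q y, C.d (n + 1) n y = x - ψ q)
    (hker : ∀ q, (∃ y, C.d (n + 1) n y = ψ q) ↔ q ∈ I • (⊤ : Submodule R Q)) :
    Module.Free (R ⧸ I) T := by
  have hd : ModuleCat.ofHom ψ ≫ C.d n ((ComplexShape.down ℕ).next n) = 0 :=
    ModuleCat.hom_ext (LinearMap.ext fun q => hψ q _)
  let lift : ModuleCat.of R Q ⟶ C.cycles n := C.liftCycles (ModuleCat.ofHom ψ) _ rfl hd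
  have hlift (q : Q) : C.iCycles n (lift q) = ψ q :=
    congrArg (fun f => f.hom q) (C.liftCycles_i (ModuleCat.ofHom ψ) _ rfl hd)
  refine free_of_ker_eq_smul_top (e.symm.toLinearMap ∘ₗ (lift ≫ C.homologyπ n).hom)
    (e.symm.surjective.comp fun h => ?_) ?_
  · obtain ⟨z, rfl⟩ := homologyπ_surjective C n h
    obtain ⟨q, hq⟩ := hsurj _ (d_iCycles C n z)
    refine ⟨q, (sub_eq_zero.1 ?_).symm⟩
    rw [← hlift, ← map_sub, ← homologyπ_eq_zero_iff, map_sub] at hq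
    exact hq
  · rw [LinearEquiv.ker_comp]
    ext q
    rw [← hker, ← hlift]
    exact homologyπ_eq_zero_iff C n (lift q)

end Homology

section Tor

open RegularTor

variable {R : Type u} [CommRing R]

/-- `Tor_n^R(M, N)` as the homology of `P ⊗ N`, for a projective resolution `P` of `M`. -/
noncomputable def torEquiv {M : ModuleCat.{u} R} (P : ProjectiveResolution M) (n : ℕ)
    (N : ModuleCat.{u} R) :
    TorObj n M N ≃ₗ[R] (((((tensoringRight (ModuleCat.{u} R)).obj N).mapHomologicalComplex
      (ComplexShape.down ℕ)).obj P.complex).homology n :) :=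
  (P.isoLeftDerivedObj ((tensoringRight (ModuleCat.{u} R)).obj N) n).toLinearEquiv

theorem torEquiv_torObjMap {M : ModuleCat.{u} R} (P : ProjectiveResolution M) (n : ℕ)
    {A B : ModuleCat.{u} R} (f : A ⟶ B) (x : TorObj n M A) :
    torEquiv P n B (torObjMap n M f x) =
      HomologicalComplex.homologyMap ((NatTrans.mapHomologicalComplex
        ((tensoringRight (ModuleCat.{u} R)).map f) (ComplexShape.down ℕ)).app P.complex) n
        (torEquiv P n A x) := by
  rw [← LinearEquiv.eq_symm_apply]
  exact congrArg (fun φ => φ.hom x)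
    (ProjectiveResolution.leftDerived_app_eq ((tensoringRight (ModuleCat.{u} R)).map f) P n)

variable (M : ModuleCat.{u} R) {S : ShortComplex (ModuleCat.{u} R)} (hS : S.ShortExact) (n : ℕ)

theorem torEquiv_torObjδ (x : TorObj (n + 1) M S.X₃) :
    torEquiv (projectiveResolution M) n S.X₁ (torObjδ n M hS x) =
      (tensorShortComplex_shortExact (projectiveResolution M) hS).δ (n + 1) n (by simp)
        (torEquiv (projectiveResolution M) (n + 1) S.X₃ x) :=
  (torEquiv (projectiveResolution M) n S.X₁).apply_symm_apply _

theorem torObj_exact₁ : Function.Exact (torObjδ n M hS) (torObjMap n M S.f) :=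
  (Function.Exact.iff_of_ladder_linearEquiv
    (e₁ := torEquiv (projectiveResolution M) (n + 1) S.X₃)
    (e₂ := torEquiv (projectiveResolution M) n S.X₁)
    (e₃ := torEquiv (projectiveResolution M) n S.X₂)
    (LinearMap.ext fun x => (torEquiv_torObjδ M hS n x).symm)
    (LinearMap.ext fun x => (torEquiv_torObjMap (projectiveResolution M) n S.f x).symm)).1
    ((ShortComplex.ShortExact.moduleCat_exact_iff_function_exact _).1
      ((tensorShortComplex_shortExact (projectiveResolution M) hS).homology_exact₁ (n + 1) n
        (by simp)))

include hS in
theorem torObj_exact₂ : Function.Exact (torObjMap n M S.f) (torObjMap n M S.g) :=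
  (Function.Exact.iff_of_ladder_linearEquiv
    (e₁ := torEquiv (projectiveResolution M) n S.X₁)
    (e₂ := torEquiv (projectiveResolution M) n S.X₂)
    (e₃ := torEquiv (projectiveResolution M) n S.X₃)
    (LinearMap.ext fun x => (torEquiv_torObjMap (projectiveResolution M) n S.f x).symm)
    (LinearMap.ext fun x => (torEquiv_torObjMap (projectiveResolution M) n S.g x).symm)).1
    ((ShortComplex.ShortExact.moduleCat_exact_iff_function_exact _).1
      ((tensorShortComplex_shortExact (projectiveResolution M) hS).homology_exact₂ n))

theorem torObj_exact₃ : Function.Exact (torObjMap (n + 1) M S.g) (torObjδ n M hS) :=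
  (Function.Exact.iff_of_ladder_linearEquiv
    (e₁ := torEquiv (projectiveResolution M) (n + 1) S.X₂)
    (e₂ := torEquiv (projectiveResolution M) (n + 1) S.X₃)
    (e₃ := torEquiv (projectiveResolution M) n S.X₁)
    (LinearMap.ext fun x => (torEquiv_torObjMap (projectiveResolution M) (n + 1) S.g x).symm)
    (LinearMap.ext fun x => (torEquiv_torObjδ M hS n x).symm)).1
    ((ShortComplex.ShortExact.moduleCat_exact_iff_function_exact _).1
      ((tensorShortComplex_shortExact (projectiveResolution M) hS).homology_exact₃ (n + 1) n
        (by simp)))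

include hS in
theorem torObjMap_zero_surjective : Function.Surjective (torObjMap 0 M S.g) := by
  have h := homologyMap_zero_surjective
    (tensorShortComplex (projectiveResolution M).complex S).g
    (LinearMap.lTensor_surjective ((projectiveResolution M).complex.X 0)
      hS.moduleCat_surjective_g)
  intro x
  obtain ⟨y, hy⟩ := h (torEquiv (projectiveResolution M) 0 S.X₃ x)
  obtain ⟨y, rfl⟩ := (torEquiv (projectiveResolution M) 0 S.X₂).surjective y
  exact ⟨y, (torEquiv (projectiveResolution M) 0 S.X₃).injective
    ((torEquiv_torObjMap (projectiveResolution M) 0 S.g y).trans hy)⟩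

end Tor

section IdealTensor

variable {R : Type*} [CommRing R] (M : Type*) [AddCommGroup M] [Module R M] (J : Ideal R)

/-- The multiplication map `M ⊗ J → M`. It identifies `M ⊗ J` with `J • M` when `M` is flat. -/
noncomputable def idealTensorMap : TensorProduct R M J →ₗ[R] M :=
  TensorProduct.rid R M ∘ₗ J.subtype.lTensor M

@[simp]
theorem idealTensorMap_tmul (m : M) (a : J) : idealTensorMap M J (m ⊗ₜ[R] a) = a.1 • m :=
  TensorProduct.rid_tmul _ _

theorem idealTensorMap_injective [Module.Flat R M] : Function.Injective (idealTensorMap M J) :=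
  (TensorProduct.rid R M).injective.comp
    (Module.Flat.lTensor_preserves_injective_linearMap _ J.subtype_injective)

theorem range_idealTensorMap : LinearMap.range (idealTensorMap M J) = J • ⊤ := by
  have : idealTensorMap M J = (TensorProduct.lid R M ∘ₗ J.subtype.rTensor M) ∘ₗ
      (TensorProduct.comm R M J).toLinearMap := by ext; simp
  rw [this, LinearMap.range_comp_of_range_eq_top _ (LinearEquiv.range _),
    Ideal.subtype_rTensor_range]

variable {M J}

theorem idealTensorMap_rTensor {N : Type*} [AddCommGroup N] [Module R N] (f : M →ₗ[R] N)
    (x : TensorProduct R M J) :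
    idealTensorMap N J (f.rTensor J x) = f (idealTensorMap M J x) := by
  induction x with
  | zero => simp only [map_zero]
  | add x y hx hy => simp only [map_add, hx, hy]
  | tmul m a => simp

theorem idealTensorMap_lTensor_inclusion {J' : Ideal R} (h : J ≤ J') (x : TensorProduct R M J) :
    idealTensorMap M J' ((Submodule.inclusion h).lTensor M x) = idealTensorMap M J x := by
  induction x with
  | zero => simp only [map_zero]
  | add x y hx hy => simp only [map_add, hx, hy]
  | tmul m a => simp

end IdealTensor

section TorIdeal

open RegularTor

variable {R : Type u} [CommRing R] {M : ModuleCat.{u} R} (P : ProjectiveResolution M)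

instance (n : ℕ) : Module.Projective R (P.complex.X n) :=
  (IsProjective.iff_projective _).2 (P.projective n)

/-- The complex `P ⊗ J`, whose homology is `Tor(M, J)`. -/
noncomputable abbrev tensorIdealComplex (J : Ideal R) : ChainComplex (ModuleCat.{u} R) ℕ :=
  (((tensoringRight (ModuleCat.{u} R)).obj (ModuleCat.of R J)).mapHomologicalComplex _).obj
    P.complex

variable {P} {I J : Ideal R} {n : ℕ}

theorem idealTensorMap_tensorIdealComplex_d (j : ℕ) (x : TensorProduct R (P.complex.X n) J) :
    idealTensorMap (P.complex.X j) J ((tensorIdealComplex P J).d n j x) =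
      P.complex.d n j (idealTensorMap (P.complex.X n) J x) :=
  idealTensorMap_rTensor (P.complex.d n j).hom x

theorem tensorIdealComplex_d_eq_zero_iff (j : ℕ) (x : TensorProduct R (P.complex.X n) J) :
    (tensorIdealComplex P J).d n j x = 0 ↔
      P.complex.d n j (idealTensorMap (P.complex.X n) J x) = 0 := by
  rw [← idealTensorMap_tensorIdealComplex_d]
  exact (map_eq_zero_iff _ (idealTensorMap_injective (P.complex.X j) J)).symm

theorem exists_tensorIdealComplex_d_eq_iff (x : TensorProduct R (P.complex.X n) J) :
    (∃ y, (tensorIdealComplex P J).d (n + 1) n y = x) ↔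
      idealTensorMap (P.complex.X n) J x ∈ (J • ⊤ : Submodule R _).map
        (P.complex.d (n + 1) n).hom := by
  rw [← range_idealTensorMap, ← LinearMap.range_comp]
  refine exists_congr fun y => (idealTensorMap_injective (P.complex.X n) J).eq_iff.symm.trans ?_
  exact Eq.congr_left (idealTensorMap_tensorIdealComplex_d n y)

variable (P)

theorem torObjMap_inclusion_eq_zero {J' : Ideal R} (h : J ≤ J')
    (hboundary : ∀ z ∈ (J • ⊤ : Submodule R (P.complex.X n)), (∀ j, P.complex.d n j z = 0) →
      z ∈ (J' • ⊤ : Submodule R _).map (P.complex.d (n + 1) n).hom) :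
    torObjMap n M (ModuleCat.ofHom (Submodule.inclusion h)) = 0 := by
  ext x
  refine (torEquiv P n _).map_eq_zero_iff.1 ?_
  rw [torEquiv_torObjMap, homologyMap_eq_zero]
  · rfl
  intro (x : TensorProduct R (P.complex.X n) J) hx
  refine (exists_tensorIdealComplex_d_eq_iff _).2 ?_
  refine Set.mem_of_eq_of_mem (idealTensorMap_lTensor_inclusion h x) ?_
  exact hboundary _ ((range_idealTensorMap _ J).le ⟨x, rfl⟩)
    fun j => (tensorIdealComplex_d_eq_zero_iff j x).1 (hx j)

theorem torObj_ideal_free [Module (R ⧸ I) (TorObj n M (ModuleCat.of R J))]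
    [IsScalarTower R (R ⧸ I) (TorObj n M (ModuleCat.of R J))] {Q : Type u} [AddCommGroup Q]
    [Module R Q] [Module.Free R Q] (ψ : Q →ₗ[R] P.complex.X n)
    (hmem : ∀ q, ψ q ∈ (J • ⊤ : Submodule R _)) (hcycle : ∀ q j, P.complex.d n j (ψ q) = 0)
    (hsurj : ∀ z ∈ (J • ⊤ : Submodule R (P.complex.X n)), (∀ j, P.complex.d n j z = 0) →
      ∃ q, z - ψ q ∈ (J • ⊤ : Submodule R _).map (P.complex.d (n + 1) n).hom)
    (hker : ∀ q, ψ q ∈ (J • ⊤ : Submodule R _).map (P.complex.d (n + 1) n).hom ↔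
      q ∈ (I • ⊤ : Submodule R Q)) :
    Module.Free (R ⧸ I) (TorObj n M (ModuleCat.of R J)) := by
  let e := LinearEquiv.ofInjective _ (idealTensorMap_injective (P.complex.X n) J)
  let lift : Q →ₗ[R] TensorProduct R (P.complex.X n) J :=
    e.symm ∘ₗ ψ.codRestrict _ fun q => (range_idealTensorMap _ J).ge (hmem q)
  have hlift (q : Q) : idealTensorMap _ J (lift q) = ψ q :=
    congrArg Subtype.val (e.apply_symm_apply _)
  refine free_of_homology (torEquiv P n _) lift (fun q j => ?_)
    (fun (x : TensorProduct R (P.complex.X n) J) hx => ?_) (fun q => ?_)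
  · refine (tensorIdealComplex_d_eq_zero_iff j (lift q)).2 ?_
    rw [hlift, hcycle]
  · obtain ⟨q, hq⟩ := hsurj (idealTensorMap _ J x) ((range_idealTensorMap _ J).le ⟨x, rfl⟩)
      fun j => (tensorIdealComplex_d_eq_zero_iff j x).1 (hx j)
    rw [← hlift, ← map_sub] at hq
    exact ⟨q, (exists_tensorIdealComplex_d_eq_iff _).2 hq⟩
  · rw [← hker, ← hlift]
    exact exists_tensorIdealComplex_d_eq_iff (lift q)

end TorIdeal

section KoszulResolution

variable {σ : Type} {R : Type u} [CommRing R] {I : Ideal R}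

instance (n : ℕ) : Module.Free R (koszulChains σ R n) :=
  .of_equiv (Finsupp.supportedEquivFinsupp _).symm

theorem eq_single_of_mem_koszulChains_zero {x : Finset σ →₀ R} (hx : x ∈ koszulChains σ R 0) :
    x = Finsupp.single ∅ (x ∅) :=
  Finsupp.eq_single_iff.2 ⟨fun S hS => by simpa using hx hS, rfl⟩

variable (σ I) in
/-- The augmentation of the Koszul complex, reducing its degree `0` part `R` modulo `I`. -/
noncomputable def koszulAugmentation : koszulChains σ R 0 →ₗ[R] R ⧸ I :=
  I.mkQ ∘ₗ Finsupp.lapply ∅ ∘ₗ (koszulChains σ R 0).subtype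

theorem koszulAugmentation_surjective : Function.Surjective (koszulAugmentation σ I) := by
  intro y
  obtain ⟨c, rfl⟩ := I.mkQ_surjective y
  exact ⟨⟨Finsupp.single ∅ c, Finsupp.single_mem_supported R c Finset.card_empty⟩,
    congrArg I.mkQ Finsupp.single_eq_same⟩

variable [LinearOrder σ]

/-- The differential of the Koszul complex from degree `n + 1` to degree `n`. -/
noncomputable def koszulComplexD (r : σ → R) (n : ℕ) :
    koszulChains σ R (n + 1) →ₗ[R] koszulChains σ R n :=
  (koszulD r).restrict fun _ => koszulD_mem_koszulChains r

/-- The Koszul complex of a family, as a chain complex of modules. -/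
noncomputable def koszulComplex (r : σ → R) : ChainComplex (ModuleCat.{u} R) ℕ :=
  .of (fun n => ModuleCat.of R (koszulChains σ R n)) (fun n => ModuleCat.ofHom (koszulComplexD r n))
    fun _ => ModuleCat.hom_ext (LinearMap.ext fun x => Subtype.ext (koszulD_koszulD r x.1))

variable {r : σ → R} {n : ℕ}

theorem koszulComplex_d (r : σ → R) (n : ℕ) :
    (koszulComplex r).d (n + 1) n = ModuleCat.ofHom (koszulComplexD r n) :=
  ChainComplex.of_d (fun n => ModuleCat.of R (koszulChains σ R n))
    (fun n => ModuleCat.ofHom (koszulComplexD r n)) n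

theorem koszulComplex_d_apply (x : koszulChains σ R (n + 1)) :
    (koszulComplex r).d (n + 1) n x = koszulComplexD r n x :=
  congrArg (fun φ => φ.hom x) (koszulComplex_d r n)

theorem koszulComplex_d_eq_zero_iff (x : koszulChains σ R n) :
    (∀ j, (koszulComplex r).d n j x = 0) ↔ koszulD r x.1 = 0 := by
  rcases n with - | n
  · refine iff_of_true (fun j => ?_) (koszulD_eq_zero_of_mem_koszulChains_zero r x.2)
    rw [(koszulComplex r).shape 0 j (by simp)]
    rfl
  · refine ⟨fun h => congrArg Subtype.val ((koszulComplex_d_apply x).symm.trans (h n)),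
      fun h j => ?_⟩
    by_cases hj : j = n
    · subst hj
      exact (koszulComplex_d_apply x).trans (Subtype.ext h)
    · rw [(koszulComplex r).shape (n + 1) j (by simpa using hj)]
      rfl

theorem mem_map_koszulComplex_d_iff (J : Ideal R) (x : koszulChains σ R n) :
    x ∈ (J • ⊤ : Submodule R (koszulChains σ R (n + 1))).map ((koszulComplex r).d (n + 1) n).hom ↔
      x.1 ∈ (J • koszulChains σ R (n + 1)).map (koszulD r) := by
  constructor
  · rintro ⟨y, hy, rfl⟩
    exact ⟨y.1, (Submodule.mem_smul_top_iff _ _ _).1 hy,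
      (congrArg Subtype.val (koszulComplex_d_apply y)).symm⟩
  · rintro ⟨y, hy, hyx⟩
    exact ⟨⟨y, Submodule.smul_le_right hy⟩, (Submodule.mem_smul_top_iff _ _ _).2 hy,
      (koszulComplex_d_apply _).trans (Subtype.ext hyx)⟩

theorem mem_map_koszulD_koszulChains_one_iff (hI : I = Ideal.span (Set.range r))
    {x : Finset σ →₀ R} (hx : x ∈ koszulChains σ R 0) :
    x ∈ (koszulChains σ R 1).map (koszulD r) ↔ x ∅ ∈ I := by
  constructor
  · rintro ⟨w, hw, rfl⟩
    simpa using map_mem_ideal_smul I (Finsupp.lapply ∅) (fun _ _ => Submodule.mem_top)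
      (koszulD_mem_smul_koszulChains hI hw)
  · intro h
    have hxI : x ∈ I ^ 1 • koszulChains σ R 0 := by
      rw [eq_single_of_mem_koszulChains_zero hx, pow_one, ← mul_one (x ∅), ← smul_eq_mul,
        ← Finsupp.smul_single]
      exact Submodule.smul_mem_smul h (Finsupp.single_mem_supported R 1 Finset.card_empty)
    obtain ⟨Z, hZ, rfl⟩ := (map_koszulEval_koszulStrand hI 0 1).ge hxI
    have hhZ := koszulReducedStrand_le (koszulHomotopy_mem_koszulReducedStrand hZ)
    exact ⟨_, Submodule.smul_le_right ((map_koszulEval_koszulStrand hI 1 0).le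
      (Submodule.mem_map_of_mem hhZ)), by
        rw [koszulD_koszulEval, polyKoszulD_koszulHomotopy hZ (polyKoszulD_eq_zero hZ)]⟩

theorem exact_koszulComplexD_koszulAugmentation (hI : I = Ideal.span (Set.range r)) :
    Function.Exact (koszulComplexD r 0) (koszulAugmentation σ I) := fun x =>
  ((Submodule.Quotient.mk_eq_zero I).trans
    (mem_map_koszulD_koszulChains_one_iff hI x.2).symm).trans
    ⟨fun ⟨w, hw, h⟩ => ⟨⟨w, hw⟩, Subtype.ext h⟩, fun ⟨w, h⟩ => ⟨w, w.2, congrArg Subtype.val h⟩⟩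

theorem IsKoszulRegular.exact_koszulComplexD (hr : IsKoszulRegular r) (n : ℕ) :
    Function.Exact (koszulComplexD r (n + 1)) (koszulComplexD r n) := by
  intro x
  constructor
  · intro hx
    obtain ⟨w, hw, h⟩ := hr n x x.2 (congrArg Subtype.val hx)
    exact ⟨⟨w, hw⟩, Subtype.ext h⟩
  · rintro ⟨w, rfl⟩
    exact Subtype.ext (koszulD_koszulD r w.1)

/-- The augmentation of the Koszul complex as a morphism of complexes. -/
noncomputable def koszulComplexπ (hI : I = Ideal.span (Set.range r)) :
    koszulComplex r ⟶ (ChainComplex.single₀ _).obj (ModuleCat.of R (R ⧸ I)) :=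
  ((koszulComplex r).toSingle₀Equiv _).symm ⟨ModuleCat.ofHom (koszulAugmentation σ I),
    ModuleCat.hom_ext (LinearMap.ext fun x =>
      (congrArg (koszulAugmentation σ I) (koszulComplex_d_apply x)).trans
        ((exact_koszulComplexD_koszulAugmentation hI).apply_apply_eq_zero x))⟩

theorem IsKoszulRegular.quasiIso_koszulComplexπ (hr : IsKoszulRegular r)
    (hI : I = Ideal.span (Set.range r)) : QuasiIso (koszulComplexπ hI) := by
  have hd (n : ℕ) : ((koszulComplex r).d (n + 1) n).hom = koszulComplexD r n :=
    congrArg ModuleCat.Hom.hom (koszulComplex_d r n)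
  have hπ : ((koszulComplexπ hI).f 0).hom = koszulAugmentation σ I :=
    congrArg ModuleCat.Hom.hom (ChainComplex.toSingle₀Equiv_symm_apply_f_zero _ _)
  refine ⟨fun n => ?_⟩
  rcases n with - | n
  · rw [ChainComplex.quasiIsoAt₀_iff, ShortComplex.quasiIso_iff_of_zeros']
    · refine ⟨(ShortComplex.ShortExact.moduleCat_exact_iff_function_exact _).2 ?_,
        (ModuleCat.epi_iff_surjective _).2 ?_⟩
      · change Function.Exact ((koszulComplex r).d 1 0).hom ((koszulComplexπ hI).f 0).hom
        rw [hd, hπ]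
        exact exact_koszulComplexD_koszulAugmentation hI
      · change Function.Surjective ((koszulComplexπ hI).f 0).hom
        rw [hπ]
        exact koszulAugmentation_surjective
    · exact (koszulComplex r).shape 0 0 (by simp)
    · exact HomologicalComplex.single_obj_d (ComplexShape.down ℕ) 0 _ 1 0
    · exact HomologicalComplex.single_obj_d (ComplexShape.down ℕ) 0 _ 0 0
  · rw [quasiIsoAt_iff_exactAt' _ _ (ChainComplex.exactAt_succ_single_obj _ _),
      HomologicalComplex.exactAt_iff' _ (n + 2) (n + 1) n (by simp) (by simp),
      ShortComplex.ShortExact.moduleCat_exact_iff_function_exact]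
    change Function.Exact ((koszulComplex r).d (n + 2) (n + 1)).hom
      ((koszulComplex r).d (n + 1) n).hom
    rw [hd, hd]
    exact hr.exact_koszulComplexD n

/-- The Koszul resolution of the quotient by the ideal of a Koszul-regular family. -/
noncomputable def IsKoszulRegular.koszulResolution (hr : IsKoszulRegular r)
    (hI : I = Ideal.span (Set.range r)) : ProjectiveResolution (ModuleCat.of R (R ⧸ I)) where
  complex := koszulComplex r
  projective n := (IsProjective.iff_projective _).1
    (inferInstanceAs (Module.Projective R (koszulChains σ R n)))
  π := koszulComplexπ hI
  quasiIso := hr.quasiIso_koszulComplexπ hI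

end KoszulResolution

section TorPowers

open RegularTor

variable {σ : Type} [LinearOrder σ] {R : Type u} [CommRing R] {r : σ → R} {I : Ideal R}

theorem IsKoszulRegular.torQuot_ideal_free (hr : IsKoszulRegular r)
    (hI : I = Ideal.span (Set.range r)) (n : ℕ) {J : Ideal R} {Q : Type u} [AddCommGroup Q]
    [Module R Q] [Module.Free R Q] (ψ : Q →ₗ[R] Finset σ →₀ R)
    (hmem : ∀ q, ψ q ∈ J • koszulChains σ R n) (hcycle : ∀ q, koszulD r (ψ q) = 0)
    (hsurj : ∀ z ∈ J • koszulChains σ R n, koszulD r z = 0 →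
      ∃ q, z - ψ q ∈ (J • koszulChains σ R (n + 1)).map (koszulD r))
    (hker : ∀ q, ψ q ∈ (J • koszulChains σ R (n + 1)).map (koszulD r) ↔
      q ∈ (I • ⊤ : Submodule R Q)) :
    Module.Free (R ⧸ I) (TorQuot I n (ModuleCat.of R J)) := by
  let ψ' : Q →ₗ[R] koszulChains σ R n :=
    ψ.codRestrict _ fun q => Submodule.smul_le_right (hmem q)
  refine torObj_ideal_free (hr.koszulResolution hI) ψ'
    (fun q => (Submodule.mem_smul_top_iff _ _ (ψ' q)).2 (hmem q))
    (fun q => (koszulComplex_d_eq_zero_iff (ψ' q)).2 (hcycle q))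
    (fun (z : koszulChains σ R n) hz hdz => ?_)
    (fun q => (mem_map_koszulComplex_d_iff J (ψ' q)).trans (hker q))
  obtain ⟨q, hq⟩ := hsurj z ((Submodule.mem_smul_top_iff _ _ z).1 hz)
    ((koszulComplex_d_eq_zero_iff z).1 hdz)
  exact ⟨q, (mem_map_koszulComplex_d_iff J (z - ψ' q)).2 hq⟩

theorem IsKoszulRegular.torQuot_self_free (hr : IsKoszulRegular r)
    (hI : I = Ideal.span (Set.range r)) (n : ℕ) :
    Module.Free (R ⧸ I) (TorQuot I n (ModuleCat.of R (⊤ : Ideal R))) := by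
  rcases n with - | n
  · have hmem (c : R) : Finsupp.lsingle (R := R) ∅ c ∈ koszulChains σ R 0 :=
      Finsupp.single_mem_supported R c Finset.card_empty
    refine hr.torQuot_ideal_free hI 0 (Q := R) (Finsupp.lsingle ∅) (fun c => ?_)
      (fun c => koszulD_eq_zero_of_mem_koszulChains_zero r (hmem c)) (fun z hz _ => ⟨z ∅, ?_⟩)
      fun c => ?_
    · simpa only [Submodule.top_smul] using hmem c
    · rw [Submodule.top_smul] at hz
      rw [eq_single_of_mem_koszulChains_zero hz]
      simp
    · rw [Submodule.top_smul, mem_map_koszulD_koszulChains_one_iff hI (hmem c)]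
      simp
  · refine hr.torQuot_ideal_free hI (n + 1) (Q := PUnit) 0 (fun _ => zero_mem _)
      (fun _ => map_zero _) (fun z hz hdz => ⟨0, ?_⟩) fun q => ?_
    · rw [Submodule.top_smul] at hz ⊢
      obtain ⟨w, hw, rfl⟩ := hr n z hz hdz
      exact ⟨w, hw, (sub_zero _).symm⟩
    · rw [Subsingleton.elim q 0]
      simp only [map_zero, zero_mem]

theorem IsKoszulRegular.torQuot_pow_free (hr : IsKoszulRegular r)
    (hI : I = Ideal.span (Set.range r)) (n s : ℕ) :
    Module.Free (R ⧸ I) (TorQuot I n (ModuleCat.of R ↥(I ^ s))) := by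
  rcases s with - | t
  · rw [pow_zero, Ideal.one_eq_top]
    exact hr.torQuot_self_free hI n
  let ψ : koszulReducedStrand σ R n t →ₗ[R] Finset σ →₀ R :=
    koszulD r ∘ₗ koszulEval r ∘ₗ Submodule.subtype _
  have hψ (W) : ψ W = koszulD r (koszulEval r W) := rfl
  refine hr.torQuot_ideal_free hI n (Q := koszulReducedStrand σ R n t) ψ (fun W => ?_)
    (fun W => ?_) (fun z hz hdz => ?_) fun W => ?_
  · rw [hψ, koszulD_koszulEval, ← map_koszulEval_koszulStrand hI]
    exact Submodule.mem_map_of_mem (polyKoszulD_mem_koszulStrand (koszulReducedStrand_le W.2))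
  · rw [hψ, koszulD_koszulD]
  · obtain ⟨W, hW, rfl⟩ := exists_koszulReducedStrand_of_koszulD_eq_zero hr hI
      (fun k _ => hr.isQuasiRegularInDegree k) hz hdz
    exact ⟨⟨W, hW⟩, 0, zero_mem _, (map_zero _).trans (sub_self _).symm⟩
  · rw [hψ, hr.koszulD_koszulEval_mem_map_iff hI W.2, Submodule.mem_smul_top_iff]

theorem IsKoszulRegular.torObjMap_powShortComplex_f (hr : IsKoszulRegular r)
    (hI : I = Ideal.span (Set.range r)) (n s : ℕ) :
    torObjMap n (ModuleCat.of R (R ⧸ I)) (powShortComplex I s).f = 0 := by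
  refine torObjMap_inclusion_eq_zero (hr.koszulResolution hI) _
    fun (z : koszulChains σ R n) hz hdz => (mem_map_koszulComplex_d_iff _ z).2 ?_
  obtain ⟨W, hW, h⟩ := exists_koszulReducedStrand_of_koszulD_eq_zero hr hI
    (fun k _ => hr.isQuasiRegularInDegree k) ((Submodule.mem_smul_top_iff _ _ z).1 hz)
    ((koszulComplex_d_eq_zero_iff z).1 hdz)
  exact ⟨_, (map_koszulEval_koszulStrand hI (n + 1) s).le
    (Submodule.mem_map_of_mem (koszulReducedStrand_le hW)), h⟩

end TorPowers

section TorQuotient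

open RegularTor

variable {R : Type u} [CommRing R] {I : Ideal R} {n : ℕ} {S : ShortComplex (ModuleCat.{u} R)}

theorem torMap_injective (hS : S.ShortExact)
    (hf : torObjMap n (ModuleCat.of R (R ⧸ I)) S.f = 0) : Function.Injective (torMap I n S.g) := by
  refine (injective_iff_map_eq_zero _).2 fun x hx => ?_
  obtain ⟨y, rfl⟩ := (torObj_exact₂ _ hS n x).1 hx
  exact congrArg (fun φ => φ.hom y) hf

theorem torδ_surjective (hS : S.ShortExact)
    (hf : torObjMap n (ModuleCat.of R (R ⧸ I)) S.f = 0) : Function.Surjective (torδ I n hS) :=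
  fun x => (torObj_exact₁ _ hS n x).1 (congrArg (fun φ => φ.hom x) hf)

theorem exact_torMap_torδ (hS : S.ShortExact) (n : ℕ) :
    Function.Exact (torMap I (n + 1) S.g) (torδ I n hS) :=
  torObj_exact₃ _ hS n

theorem torMap_zero_bijective (hS : S.ShortExact)
    (hf : torObjMap 0 (ModuleCat.of R (R ⧸ I)) S.f = 0) : Function.Bijective (torMap I 0 S.g) :=
  ⟨torMap_injective hS hf, torObjMap_zero_surjective _ hS⟩

theorem torQuot_free_of_shortExact (hS : S.ShortExact)
    (hf : ∀ n, torObjMap n (ModuleCat.of R (R ⧸ I)) S.f = 0)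
    [∀ n, Module.Free (R ⧸ I) (TorQuot I n S.X₁)] [∀ n, Module.Free (R ⧸ I) (TorQuot I n S.X₂)]
    (n : ℕ) : Module.Free (R ⧸ I) (TorQuot I n S.X₃) := by
  rcases n with - | n
  · exact .of_equiv (LinearEquiv.ofBijective _ (torMap_zero_bijective hS (hf 0)))
  · exact free_of_exact (torMap_injective hS (hf (n + 1))) (exact_torMap_torδ hS n)
      (torδ_surjective hS (hf n))

end TorQuotient

open RegularTor in
theorem theorem1_general {σ : Type} [LinearOrder σ] {R : Type u} [CommRing R] {r : σ → R}
    (hr : IsKoszulRegular r) {I : Ideal R} (hI : I = Ideal.span (Set.range r)) (s : ℕ) :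
    (∀ n : ℕ,
      Module.Free (R ⧸ I) (TorQuot I n (ModuleCat.of R ↥(I ^ s))) ∧
      Module.Free (R ⧸ I) (TorQuot I n
        (ModuleCat.of R (↥(I ^ s) ⧸ Submodule.submoduleOf (I ^ (s + 1)) (I ^ s)))) ∧
      Module.Free (R ⧸ I) (TorQuot I n (ModuleCat.of R ↥(I ^ (s + 1))))) ∧
    Function.Bijective (torMap I 0 (powShortComplex I s).g) ∧
    (∀ n : ℕ,
      Function.Injective (torMap I (n + 1) (powShortComplex I s).g) ∧
      Function.Exact (torMap I (n + 1) (powShortComplex I s).g)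
        (torδ I n (powShortComplex_shortExact I s)) ∧
      Function.Surjective (torδ I n (powShortComplex_shortExact I s))) := by
  have hS := powShortComplex_shortExact I s
  have hzero (n : ℕ) := hr.torObjMap_powShortComplex_f hI n s
  have hX₁ (n : ℕ) : Module.Free (R ⧸ I) (TorQuot I n (powShortComplex I s).X₁) :=
    hr.torQuot_pow_free hI n (s + 1)
  have hX₂ (n : ℕ) : Module.Free (R ⧸ I) (TorQuot I n (powShortComplex I s).X₂) :=
    hr.torQuot_pow_free hI n s
  exact ⟨fun n => ⟨hX₂ n, torQuot_free_of_shortExact hS hzero n, hX₁ n⟩,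
    torMap_zero_bijective hS (hzero 0), fun n => ⟨torMap_injective hS (hzero (n + 1)),
      exact_torMap_torδ hS n, torδ_surjective hS (hzero n)⟩⟩

open RegularTor in
theorem theorem1 {R : Type u} [CommRing R] (rs : List R)
    (hrs : RingTheory.Sequence.IsWeaklyRegular R rs) (I : Ideal R) (hI : I = Ideal.ofList rs)
    (s : ℕ) :
    (∀ n : ℕ,
      Module.Free (R ⧸ I) (TorQuot I n (ModuleCat.of R ↥(I ^ s))) ∧
      Module.Free (R ⧸ I) (TorQuot I n
        (ModuleCat.of R (↥(I ^ s) ⧸ Submodule.submoduleOf (I ^ (s + 1)) (I ^ s)))) ∧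
      Module.Free (R ⧸ I) (TorQuot I n (ModuleCat.of R ↥(I ^ (s + 1))))) ∧
    Function.Bijective (torMap I 0 (powShortComplex I s).g) ∧
    (∀ n : ℕ,
      Function.Injective (torMap I (n + 1) (powShortComplex I s).g) ∧
      Function.Exact (torMap I (n + 1) (powShortComplex I s).g)
        (torδ I n (powShortComplex_shortExact I s)) ∧
      Function.Surjective (torδ I n (powShortComplex_shortExact I s))) :=
  theorem1_general (isKoszulRegular_get hrs) (by rw [hI, Ideal.ofList, Set.range_list_get]) s
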